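/- **Definitions.** Let $A$ be a finite totally ordered alphabet. A word is a finite sequence of letters of $A$, a sentence is a finite sequence of nonempty words, and a weak sentence is an infinite sequence of words of which only finitely many are nonempty. Words are ordered by length and then lexicographically; a p-sentence is a sentence whose words are weakly decreasing for this order. For a sentence $I$ let $\mathrm{sort}(I)$ be the p-sentence obtained by sorting its words; for a weak sentence $K$ let $\mathrm{sort}(K)$ be the p-sentence obtained by deleting the empty words and sorting. Let $\emptyset$ be the empty p-sentence. For a p-sentence $P=(w_1,\dots,w_k)$ let $w\ell(P)=(|w_1|,\dots,|w_k|)$, a partition. Consider variables $x_{a,i}$ ($a\in A$, $i\ge 1$) in which $x_{a,i}$ and $x_{b,j}$ commute for $i\neq j$ (and there are no other relations). Every monomial is $x_K=x_{w_1,1}x_{w_2,2}\cdots$ for a unique weak sentence $K=(w_1,w_2,\dots)$, where $x_{w,i}=x_{a_1,i}\cdots x_{a_r,i}$ for $w=a_1\cdots a_r$. Let $QSym_A$ be the space of formal power series over $\mathbb{Q}$ of bounded degree in these variables in which any two monomials with the same underlying sentence (the list of nonempty words of $K$) have equal coefficients. It has the basis $M_I=\sum x_K$ (sum over $K$ with underlying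 sentence $I$), and the comultiplication $\Delta(M_I)=\sum_{I=J\cdot K}M_J\otimes M_K$. Let $Sym_A\subseteq QSym_A$ be the algebra of the series of bounded degree that are invariant under all permutations of the second indices of the variables, with the product of power series, the comultiplication restricted from $QSym_A$, and the constant coefficient as counit. It has the basis $m_P=\sum_{\mathrm{sort}(K)=P}x_K$, indexed by the p-sentences $P$. Let $Sym$ be the algebra of symmetric functions over $\mathbb{Q}$ in $x_1,x_2,\dots$ (symmetric formal power series of bounded degree), with the monomial basis $m_\lambda$, the comultiplication $\Delta(m_\lambda)=\sum_{\mu\sqcup\nu=\lambda}m_\mu\otimes m_\nu$ (sum over the ordered pairs of partitions with multiset union $\lambda$), and the constant coefficient as counit. The uncoloring map $\upsilon: Sym_A\to Sym$ is the linear map with $\upsilon(m_P)=m_{w\ell(P)}$. For p-sentences $P,S,Q$ let $r^Q_{P,S}$ be the number of pairs of weak sentences $(Y,Z)$ with $\mathrm{sort}(Y)=P$, $\mathrm{sort}(Z)=S$ and $(y_1z_1,y_2z_2,\dots)=Q$ (padded by empty words). For partitions let $r^\nu_{\lambda,\mu}$ be the number of pairs $(\alpha,\beta)$ of finitely supported sequences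 of nonnegative integers whose nonzero entries sort to $\lambda$ and $\mu$ and with $(\alpha_1+\beta_1,\alpha_2+\beta_2,\dots)=\nu$ (padded by zeros). Write $Q\sqsubseteq P$ if the words of $Q$ form a submultiset of the words of $P$, and then let $P\setminus Q$ be the p-sentence formed by the remaining words. **Proposition.** Suppose that $|A|=1$. Then $Sym_A$ and $Sym$, with the structures above, are Hopf algebras, and $\upsilon: Sym_A\to Sym$ is an isomorphism of Hopf algebras: it is bijective, it is a morphism of algebras and of coalgebras, and it commutes with the antipodes. Moreover, in $Sym_A$ $$m_Pm_S=\sum_Q r^Q_{P,S}\,m_Q \ \text{(a finite sum)},\qquad \Delta(m_P)=\sum_{Q\sqsubseteq P}m_Q\otimes m_{P\setminus Q},\qquad \epsilon(m_\emptyset)=1,\quad \epsilon(m_P)=0\ (P\ne\emptyset),$$ and in $Sym$, for $\lambda\vdash n$ and $\mu\vdash k$, $$m_\lambda m_\mu=\sum_{\nu\vdash n+k}r^\nu_{\lambda,\mu}\,m_\nu,\qquad \Delta(m_\lambda)=\sum_{\mu\sqcup\nu=\lambda}m_\mu\otimes m_\nu,$$ and these rules match: $P\mapsto w\ell(P)$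 is a bijection from p-sentences to partitions, $r^Q_{P,S}=r^{w\ell(Q)}_{w\ell(P),w\ell(S)}$ for all $P,S,Q$, and for every $P$ the pairs $(\mu,\nu)$ with $\mu\sqcup\nu=w\ell(P)$ are exactly the pairs $(w\ell(Q),w\ell(P\setminus Q))$ with $Q\sqsubseteq P$. -/

import Mathlib

open scoped TensorProduct

namespace ColoredSym

noncomputable section

/-- The multiset of nonzero values of a finitely supported sequence. -/
def parts {X : Type*} [Zero X] (K : ℕ →₀ X) : Multiset X := K.support.val.map K

/-- The list of nonzero values of a finitely supported sequence, in order. -/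
def entries {X : Type*} [Zero X] (K : ℕ →₀ X) : List X := (K.support.sort (· ≤ ·)).map K

open Classical in
/-- The sequence `(l₀, l₁, …, lₖ, 0, 0, …)` attached to a list. -/
def place {X : Type*} [Zero X] (l : List X) : ℕ →₀ X := l.toFinsupp

theorem coe_entries {X : Type*} [Zero X] (K : ℕ →₀ X) : (entries K : Multiset X) = parts K := by
  rw [entries, parts, ← Multiset.map_coe, Finset.sort_eq]

theorem zero_notMem_entries {X : Type*} [Zero X] (K : ℕ →₀ X) : (0 : X) ∉ entries K := by
  simp [entries]

theorem entries_place {X : Type*} [Zero X] (l : List X) (hl : (0 : X) ∉ l) :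
    entries (place l) = l := by
  classical
  have hs : (place l).support = Finset.range l.length := by
    ext i
    simp only [place, Finsupp.mem_support_iff, List.toFinsupp_apply, Finset.mem_range]
    constructor
    · intro h
      by_contra h'
      exact h (List.getD_eq_default _ _ (by omega))
    · intro h h0
      rw [List.getD_eq_getElem _ _ h] at h0
      exact hl (h0 ▸ List.getElem_mem h)
  rw [entries, hs, Finset.sort_range]
  apply List.ext_getElem
  · simp
  · intro i h1 h2
    simp [place, h2]

theorem exists_perm_of_parts_eq {X : Type*} [Zero X] (K L : ℕ →₀ X) (h : parts K = parts L) :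
    ∃ σ : Equiv.Perm ℕ, K.equivMapDomain σ = L := by
  classical
  have key : ∀ x : X, Nonempty ({i // K i = x} ≃ {i // L i = x}) := by
    intro x
    by_cases hx : x = 0
    · subst hx
      have hinf : ∀ M : ℕ →₀ X, Infinite {i // M i = 0} := by
        intro M
        have : {i | M i = 0}.Infinite := by
          have h2 := (M.support.finite_toSet).infinite_compl
          convert h2 using 1
          ext i
          simp
        exact this.to_subtype
      have := hinf K
      have := hinf L
      exact nonempty_equiv_of_countable
    · have hcard : ∀ M : ℕ →₀ X, ∃ s : Finset ℕ, (∀ i, i ∈ s ↔ M i = x) ∧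
          s.card = (parts M).count x := by
        intro M
        refine ⟨M.support.filter (fun i => x = M i), fun i => ?_, ?_⟩
        · simp only [Finset.mem_filter, Finsupp.mem_support_iff]
          exact ⟨fun h => h.2.symm, fun h => ⟨by rwa [h], h.symm⟩⟩
        · rw [parts, Multiset.count_map]
          rfl
      obtain ⟨s, hs, hs'⟩ := hcard K
      obtain ⟨t, ht, ht'⟩ := hcard L
      have hst : s.card = t.card := by rw [hs', ht', h]
      exact ⟨(Equiv.subtypeEquivRight (fun i => (hs i).symm)).trans
        ((Finset.equivOfCardEq hst).trans (Equiv.subtypeEquivRight ht))⟩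
  have e := fun x => Classical.choice (key x)
  let σ : Equiv.Perm ℕ := (Equiv.sigmaFiberEquiv K).symm.trans
    ((Equiv.sigmaCongrRight e).trans (Equiv.sigmaFiberEquiv L))
  have hσ : ∀ i, L (σ i) = K i := by
    intro i
    exact (e (K i) ⟨i, rfl⟩).2
  refine ⟨σ, ?_⟩
  ext j
  obtain ⟨i, rfl⟩ := σ.surjective j
  rw [Finsupp.equivMapDomain_apply, Equiv.symm_apply_apply, hσ]

theorem parts_equivMapDomain {X : Type*} [Zero X] (K : ℕ →₀ X) (σ : Equiv.Perm ℕ) :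
    parts (K.equivMapDomain σ) = parts K := by
  simp only [parts, Finsupp.equivMapDomain, Finset.map_val, Multiset.map_map]
  refine Multiset.map_congr rfl fun i _ => ?_
  simp

/-- A basis of a space `V` of functions `X → ℚ`, for `V` consisting of functions that factor through
`key : X → ι` and take nonzero values on finitely many classes, and containing the indicator `m i`
of each class. -/
def basisOfKey {X ι V : Type*} [AddCommGroup V] [Module ℚ V] (c : V →ₗ[ℚ] (X → ℚ))
    (hc : Function.Injective c) (key : X → ι) (s : ι → X) (hs : ∀ i, key (s i) = i) (m : ι → V)
    (hm : ∀ i, c (m i) (s i) = 1 ∧ ∀ x, key x ≠ i → c (m i) x = 0)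
    (hV : ∀ f x, c f x = c f (s (key x))) (hfin : ∀ f, {i | c f (s i) ≠ 0}.Finite) :
    Module.Basis ι ℚ V :=
  have hms : ∀ i j, c (m i) (s j) = Finsupp.single i (1 : ℚ) j := by
    classical
    intro i j
    rw [Finsupp.single_apply]
    split_ifs with h
    · rw [← h]; exact (hm i).1
    · exact (hm i).2 _ (by rw [hs]; exact fun h' => h h'.symm)
  have hlin : ∀ (a : ι →₀ ℚ) (j : ι), c (Finsupp.linearCombination ℚ m a) (s j) = a j := by
    intro a j
    rw [Finsupp.linearCombination_apply, Finsupp.sum, map_sum, Finset.sum_apply]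
    simp only [map_smul, Pi.smul_apply, hms, smul_eq_mul]
    conv_rhs => rw [← Finsupp.sum_single a, Finsupp.sum, Finsupp.finsetSum_apply]
    refine Finset.sum_congr rfl fun i _ => ?_
    classical
    simp [Finsupp.single_apply]
  Module.Basis.ofRepr
    { toFun := fun f => ⟨(hfin f).toFinset, fun i => c f (s i), by simp⟩
      map_add' := fun f g => by ext i; exact congrFun (map_add c f g) (s i)
      map_smul' := fun r f => by ext i; exact congrFun (map_smul c r f) (s i)
      invFun := Finsupp.linearCombination ℚ m
      left_inv := fun f => by
        apply hc
        funext x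
        rw [hV, hlin]; exact (hV f x).symm
      right_inv := fun a => by
        ext j
        exact hlin a j }

theorem basisOfKey_apply {X ι V : Type*} [AddCommGroup V] [Module ℚ V] (c : V →ₗ[ℚ] (X → ℚ))
    (hc : Function.Injective c) (key : X → ι) (s : ι → X) (hs : ∀ i, key (s i) = i) (m : ι → V)
    (hm : ∀ i, c (m i) (s i) = 1 ∧ ∀ x, key x ≠ i → c (m i) x = 0)
    (hV : ∀ f x, c f x = c f (s (key x))) (hfin : ∀ f, {i | c f (s i) ≠ 0}.Finite) (i : ι) :
    basisOfKey c hc key s hs m hm hV hfin i = m i := by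
  change Finsupp.linearCombination ℚ m (Finsupp.single i 1) = m i
  simp

/-! ### Words, sentences, p-sentences -/

/-- Words over `A`; the sum of two words is their concatenation, and `0` is the empty word. -/
abbrev Word (A : Type*) := FreeAddMonoid A

/-- Sentences: finite sequences of nonempty words. -/
abbrev Sent (A : Type*) := {I : List (Word A) // 0 ∉ I}

/-- Weak sentences: infinite sequences of words, finitely many of them nonempty.
Sums of weak sentences are taken entry by entry. -/
abbrev WSent (A : Type*) := ℕ →₀ Word A

/-- The flattening of a weak sentence: its nonempty words, in order. -/
def flatten {A : Type*} (K : WSent A) : Sent A := ⟨entries K, zero_notMem_entries K⟩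

/-- The size (number of letters) of a weak sentence. -/
def WSent.size {A : Type*} (K : WSent A) : ℕ := K.sum fun _ w => w.length

/-- Concatenation of sentences. -/
def Sent.concat {A : Type*} (J K : Sent A) : Sent A :=
  ⟨J.1 ++ K.1, by simpa using ⟨J.2, K.2⟩⟩

/-- The graded lexicographic order on words: `v` precedes `w` if `v` is shorter, or if they have
the same length and `v` is lexicographically at most `w`. -/
def GLexLE {A : Type*} [LinearOrder A] (v w : Word A) : Prop :=
  v.length < w.length ∨ v.length = w.length ∧ v.toList ≤ w.toList

theorem glexLE_iff {A : Type*} [LinearOrder A] (v w : Word A) : GLexLE v w ↔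
    (toLex (v.length, v.toList) : ℕ ×ₗ List A) ≤ toLex (w.length, w.toList) := by
  rw [Prod.Lex.toLex_le_toLex]; rfl

instance {A : Type*} [LinearOrder A] : Std.Total (fun v w : Word A => GLexLE w v) :=
  ⟨fun v w => by simp only [glexLE_iff]; exact le_total _ _⟩

instance {A : Type*} [LinearOrder A] : IsTrans (Word A) (fun v w : Word A => GLexLE w v) :=
  ⟨fun u v w h h' => by simp only [glexLE_iff] at *; exact h'.trans h⟩

instance {A : Type*} [LinearOrder A] : Std.Antisymm (fun v w : Word A => GLexLE w v) :=
  ⟨fun v w h h' => by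
    simp only [glexLE_iff] at *
    have := le_antisymm h' h
    exact FreeAddMonoid.toList.injective (Prod.ext_iff.1 (toLex.injective this)).2⟩

/-- p-sentences: sentences whose words are weakly decreasing in the graded lexicographic order. -/
abbrev PSent (A : Type*) [LinearOrder A] :=
  {P : List (Word A) // 0 ∉ P ∧ P.Pairwise (fun v w => GLexLE w v)}

/-- A p-sentence as a sentence. -/
def PSent.toSent {A : Type*} [LinearOrder A] (P : PSent A) : Sent A := ⟨P.1, P.2.1⟩

open Classical in
/-- The p-sentence obtained by sorting a sentence. -/
def sort {A : Type*} [LinearOrder A] (I : Sent A) : PSent A :=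
  ⟨I.1.insertionSort (fun v w => GLexLE w v), by simpa only [List.mem_insertionSort] using I.2,
    List.pairwise_insertionSort _ _⟩

/-- The sorting of a weak sentence: sort its flattening. -/
def wsort {A : Type*} [LinearOrder A] (K : WSent A) : PSent A := sort (flatten K)

theorem coe_sort {A : Type*} [LinearOrder A] (I : Sent A) :
    ((sort I).1 : Multiset (Word A)) = I.1 := by
  classical
  exact Multiset.coe_eq_coe.2 (List.perm_insertionSort _ _)

theorem psent_ext {A : Type*} [LinearOrder A] {P Q : PSent A}
    (h : (P.1 : Multiset (Word A)) = Q.1) : P = Q :=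
  Subtype.ext ((Multiset.coe_eq_coe.1 h).eq_of_pairwise' P.2.2 Q.2.2)

theorem sort_eq_iff {A : Type*} [LinearOrder A] (I : Sent A) (P : PSent A) :
    sort I = P ↔ (I.1 : Multiset (Word A)) = P.1 := by
  rw [← coe_sort]
  exact ⟨fun h => h ▸ rfl, psent_ext⟩

theorem wsort_eq_iff {A : Type*} [LinearOrder A] (K : WSent A) (P : PSent A) :
    wsort K = P ↔ parts K = P.1 := by
  rw [wsort, sort_eq_iff, flatten, coe_entries]

theorem flatten_place {A : Type*} (I : Sent A) : flatten (place I.1) = I :=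
  Subtype.ext (entries_place I.1 I.2)

theorem sort_toSent {A : Type*} [LinearOrder A] (P : PSent A) : sort P.toSent = P := by
  rw [sort_eq_iff]; rfl

theorem wsort_place {A : Type*} [LinearOrder A] (P : PSent A) : wsort (place P.1) = P := by
  rw [wsort, show (place P.1 : WSent A) = place P.toSent.1 from rfl, flatten_place, sort_toSent]

theorem wsent_size_eq {A : Type*} (K : WSent A) :
    K.size = ((parts K).map FreeAddMonoid.length).sum := by
  rw [WSent.size, parts, Multiset.map_map]; rfl

theorem wsent_size_place {A : Type*} (I : Sent A) :
    WSent.size (place I.1) = (I.1.map FreeAddMonoid.length).sum := by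
  rw [wsent_size_eq, ← coe_entries, entries_place I.1 I.2]; rfl

theorem wsent_size_add {A : Type*} (K L : WSent A) : (K + L).size = K.size + L.size := by
  classical
  exact Finsupp.sum_add_index' (fun _ => rfl) (fun _ _ _ => FreeAddMonoid.length_add _ _)

theorem finite_sent_size_le {A : Type*} [Finite A] (n : ℕ) :
    {I : Sent A | (I.1.map FreeAddMonoid.length).sum ≤ n}.Finite := by
  have hw : {w : Word A | w.length ≤ n}.Finite := List.finite_length_le A n
  have := hw.to_subtype
  have h2 := (List.finite_length_le {w : Word A | w.length ≤ n} n).image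
    (fun l => l.map Subtype.val)
  refine Set.Finite.of_finite_image (f := Subtype.val) (h2.subset ?_) Subtype.val_injective.injOn
  rintro _ ⟨I, hI, rfl⟩
  have hmem : ∀ w ∈ I.1, w.length ≤ n := fun w hw =>
    (List.single_le_sum (by simp) _ (List.mem_map_of_mem hw)).trans hI
  refine ⟨I.1.pmap Subtype.mk hmem, ?_, ?_⟩
  · simp only [Set.mem_ofPred_eq, List.length_pmap]
    refine le_trans ?_ hI
    have : (I.1.map FreeAddMonoid.length).length ≤ (I.1.map FreeAddMonoid.length).sum := by
      apply List.length_le_sum_of_one_le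
      intro i hi
      obtain ⟨w, hw, rfl⟩ := List.mem_map.1 hi
      rw [Nat.one_le_iff_ne_zero]
      intro h0
      exact I.2 (FreeAddMonoid.length_eq_zero.1 h0 ▸ hw)
    simpa using this
  · simp [List.map_pmap]

/-! ### Power series in partially commutative variables -/

theorem finite_antidiagonal {A : Type*} (K : WSent A) :
    {p : WSent A × WSent A | p.1 + p.2 = K}.Finite := by
  classical
  have hw : ∀ w : Word A, {p : Word A × Word A | p.1 + p.2 = w}.Finite := by
    intro w
    have : {l : List A | l <+: w.toList}.Finite := by
      refine (w.toList.inits.toFinset.finite_toSet).subset fun l hl => ?_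
      simpa using hl
    have h2 : {l : List A | l <:+ w.toList}.Finite := by
      refine (w.toList.tails.toFinset.finite_toSet).subset fun l hl => ?_
      simpa using hl
    refine (this.prod h2).subset ?_
    rintro ⟨u, v⟩ h
    have h : FreeAddMonoid.toList u ++ FreeAddMonoid.toList v = FreeAddMonoid.toList w := congrArg FreeAddMonoid.toList h
    exact ⟨⟨_, h⟩, ⟨_, h⟩⟩
  let S : ℕ → Finset (Word A × Word A) := fun i => (hw (K i)).toFinset
  have hS : ∀ (p : WSent A × WSent A), p.1 + p.2 = K → ∀ i, (p.1 i, p.2 i) ∈ S i := by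
    intro p hp i
    simp only [S, Set.Finite.mem_toFinset, Set.mem_ofPred_eq]
    rw [← hp]; rfl
  have h0 : ∀ (p : WSent A × WSent A), p.1 + p.2 = K → ∀ i, K i = 0 → p.1 i = 0 ∧ p.2 i = 0 := by
    intro p hp i hi
    have : p.1 i + p.2 i = 0 := by rw [← hi, ← hp]; rfl
    have h : (p.1 i).length + (p.2 i).length = 0 := by
      rw [← FreeAddMonoid.length_add, this]; rfl
    exact ⟨FreeAddMonoid.length_eq_zero.1 (by omega), FreeAddMonoid.length_eq_zero.1 (by omega)⟩
  let F : Finset (WSent A) := K.support.finsupp (fun i => (S i).image Prod.fst)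
  let G : Finset (WSent A) := K.support.finsupp (fun i => (S i).image Prod.snd)
  refine ((F ×ˢ G).finite_toSet).subset fun p hp => ?_
  rw [Finset.mem_coe, Finset.mem_product, Finset.mem_finsupp_iff, Finset.mem_finsupp_iff]
  refine ⟨⟨fun i hi => ?_, fun i _ => Finset.mem_image_of_mem Prod.fst (hS p hp i)⟩,
    ⟨fun i hi => ?_, fun i _ => Finset.mem_image_of_mem Prod.snd (hS p hp i)⟩⟩
  · rw [Finsupp.mem_support_iff] at hi ⊢
    exact fun h => hi (h0 p hp i h).1
  · rw [Finsupp.mem_support_iff] at hi ⊢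
    exact fun h => hi (h0 p hp i h).2

/-- The finite set of factorizations of the monomial `x_K`. -/
instance {A : Type*} : Finset.HasAntidiagonal (WSent A) where
  antidiagonal K := (finite_antidiagonal K).toFinset
  mem_antidiagonal := by simp

/-- Formal power series with rational coefficients in the partially commutative variables
`x_{a,i}` (`a ∈ A`, `i ∈ ℕ`), where `x_{a,i}` and `x_{b,j}` commute for `i ≠ j`. Ordering a monomial
by its second indices identifies it with `x_K = x_{K 0, 0} x_{K 1, 1} ⋯` for a unique weak sentence
`K`, and `x_K x_L = x_{K + L}`. A series is the family of the coefficients of the `x_K`. -/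
def PCSeries (A : Type*) := WSent A → ℚ

instance {A : Type*} : AddCommGroup (PCSeries A) := inferInstanceAs (AddCommGroup (WSent A → ℚ))

instance {A : Type*} : Module ℚ (PCSeries A) := inferInstanceAs (Module ℚ (WSent A → ℚ))

theorem PCSeries.ext {A : Type*} {f g : PCSeries A} (h : ∀ K, f K = g K) : f = g := funext h

instance {A : Type*} : Mul (PCSeries A) :=
  ⟨fun f g K => ∑ p ∈ Finset.HasAntidiagonal.antidiagonal K, f p.1 * g p.2⟩

open Classical in
instance {A : Type*} : One (PCSeries A) := ⟨fun K => if K = 0 then 1 else 0⟩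

theorem PCSeries.mul_apply {A : Type*} (f g : PCSeries A) (K : WSent A) :
    (f * g) K = ∑ p ∈ Finset.HasAntidiagonal.antidiagonal K, f p.1 * g p.2 := rfl

theorem PCSeries.add_apply {A : Type*} (f g : PCSeries A) (K : WSent A) :
    (f + g) K = f K + g K := rfl

theorem PCSeries.zero_apply {A : Type*} (K : WSent A) : (0 : PCSeries A) K = 0 := rfl

theorem PCSeries.smul_apply {A : Type*} (r : ℚ) (f : PCSeries A) (K : WSent A) :
    (r • f) K = r * f K := rfl

theorem PCSeries.one_apply_zero {A : Type*} : (1 : PCSeries A) (0 : WSent A) = 1 :=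
  if_pos rfl

theorem PCSeries.one_apply_ne {A : Type*} {K : WSent A} (h : K ≠ 0) : (1 : PCSeries A) K = 0 :=
  if_neg h

instance {A : Type*} : Ring (PCSeries A) where
  __ := (inferInstance : AddCommGroup (PCSeries A))
  left_distrib f g h := PCSeries.ext fun K => by
    simp only [PCSeries.mul_apply, PCSeries.add_apply, mul_add, Finset.sum_add_distrib]
  right_distrib f g h := PCSeries.ext fun K => by
    simp only [PCSeries.mul_apply, PCSeries.add_apply, add_mul, Finset.sum_add_distrib]
  zero_mul f := PCSeries.ext fun K => by
    simp [PCSeries.mul_apply, PCSeries.zero_apply]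
  mul_zero f := PCSeries.ext fun K => by
    simp [PCSeries.mul_apply, PCSeries.zero_apply]
  one_mul f := PCSeries.ext fun K => by
    rw [PCSeries.mul_apply, Finset.sum_eq_single_of_mem (0, K)
      (by simp [Finset.HasAntidiagonal.mem_antidiagonal])]
    · exact (congrArg (· * f K) PCSeries.one_apply_zero).trans (one_mul _)
    · rintro ⟨I, J⟩ hp hne
      have hI : I ≠ 0 := by
        rintro rfl
        simp only [Finset.HasAntidiagonal.mem_antidiagonal, zero_add] at hp
        exact hne (by rw [hp])
      exact (congrArg (· * f J) (PCSeries.one_apply_ne hI)).trans (zero_mul _)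
  mul_one f := PCSeries.ext fun K => by
    rw [PCSeries.mul_apply, Finset.sum_eq_single_of_mem (K, 0)
      (by simp [Finset.HasAntidiagonal.mem_antidiagonal])]
    · exact (congrArg (f K * ·) PCSeries.one_apply_zero).trans (mul_one _)
    · rintro ⟨I, J⟩ hp hne
      have hJ : J ≠ 0 := by
        rintro rfl
        simp only [Finset.HasAntidiagonal.mem_antidiagonal, add_zero] at hp
        exact hne (by rw [hp])
      exact (congrArg (f I * ·) (PCSeries.one_apply_ne hJ)).trans (mul_zero _)
  mul_assoc f g h := PCSeries.ext fun K => by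
    simp only [PCSeries.mul_apply, Finset.sum_mul, Finset.mul_sum, Finset.sum_sigma']
    refine Finset.sum_nbij' (fun q => ⟨(q.2.1, q.2.2 + q.1.2), (q.2.2, q.1.2)⟩)
      (fun q => ⟨(q.1.1 + q.2.1, q.2.2), (q.1.1, q.2.1)⟩) ?_ ?_ ?_ ?_ ?_
    · rintro ⟨⟨a, b⟩, ⟨c, d⟩⟩ hq
      simp only [Finset.mem_sigma, Finset.HasAntidiagonal.mem_antidiagonal] at hq ⊢
      exact ⟨by rw [← hq.1, ← hq.2, add_assoc], trivial⟩
    · rintro ⟨⟨a, b⟩, ⟨c, d⟩⟩ hq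
      simp only [Finset.mem_sigma, Finset.HasAntidiagonal.mem_antidiagonal] at hq ⊢
      exact ⟨by rw [← hq.1, ← hq.2, add_assoc], trivial⟩
    · rintro ⟨⟨a, b⟩, ⟨c, d⟩⟩ hq
      simp only [Finset.mem_sigma, Finset.HasAntidiagonal.mem_antidiagonal] at hq
      obtain ⟨-, rfl⟩ := hq
      rfl
    · rintro ⟨⟨a, b⟩, ⟨c, d⟩⟩ hq
      simp only [Finset.mem_sigma, Finset.HasAntidiagonal.mem_antidiagonal] at hq
      obtain ⟨-, rfl⟩ := hq
      rfl
    · rintro ⟨⟨a, b⟩, ⟨c, d⟩⟩ hq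
      exact mul_assoc _ _ _

instance {A : Type*} : Algebra ℚ (PCSeries A) :=
  Algebra.ofModule
    (fun r f g => PCSeries.ext fun K => by
      simp only [PCSeries.mul_apply, PCSeries.smul_apply, Finset.mul_sum, mul_assoc])
    (fun r f g => PCSeries.ext fun K => by
      simp only [PCSeries.mul_apply, PCSeries.smul_apply, Finset.mul_sum, mul_left_comm])

/-- `Sym_A`: the series of bounded degree that are invariant under all permutations of the second
indices of the variables. -/
def SymA (A : Type*) : Subalgebra ℚ (PCSeries A) where
  carrier := {f | (∃ n : ℕ, ∀ K, f K ≠ 0 → K.size ≤ n) ∧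
    ∀ (σ : Equiv.Perm ℕ) (K : WSent A), f (K.equivMapDomain σ) = f K}
  add_mem' := by
    rintro f g ⟨⟨n, hn⟩, hf⟩ ⟨⟨m, hm⟩, hg⟩
    refine ⟨⟨max n m, fun K hK => ?_⟩, fun σ K => ?_⟩
    · by_cases h : f K = 0
      · refine (hm K fun h' => hK ?_).trans (le_max_right _ _)
        rw [PCSeries.add_apply, h, h', add_zero]
      · exact (hn K h).trans (le_max_left _ _)
    · rw [PCSeries.add_apply, PCSeries.add_apply, hf, hg]
  mul_mem' := by
    rintro f g ⟨⟨n, hn⟩, hf⟩ ⟨⟨m, hm⟩, hg⟩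
    refine ⟨⟨n + m, fun K hK => ?_⟩, fun σ K => ?_⟩
    · obtain ⟨p, hp, h⟩ := Finset.exists_ne_zero_of_sum_ne_zero hK
      rw [Finset.HasAntidiagonal.mem_antidiagonal] at hp
      rw [← hp, wsent_size_add]
      exact add_le_add (hn _ (left_ne_zero_of_mul h)) (hm _ (right_ne_zero_of_mul h))
    · rw [PCSeries.mul_apply, PCSeries.mul_apply]
      symm
      refine Finset.sum_nbij'
        (fun p => (p.1.equivMapDomain σ, p.2.equivMapDomain σ))
        (fun p => (p.1.equivMapDomain σ.symm, p.2.equivMapDomain σ.symm)) ?_ ?_ ?_ ?_ ?_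
      · intro p hp
        rw [Finset.HasAntidiagonal.mem_antidiagonal] at hp ⊢
        rw [← hp]
        ext i; rfl
      · intro p hp
        rw [Finset.HasAntidiagonal.mem_antidiagonal] at hp ⊢
        ext i
        have := DFunLike.congr_fun hp (σ i)
        simpa using this
      · intro p _
        ext i <;> simp
      · intro p _
        ext i <;> simp
      · intro p _
        simp only [hf, hg]
  algebraMap_mem' := by
    intro r
    rw [Algebra.algebraMap_eq_smul_one]
    refine ⟨⟨0, fun K hK => ?_⟩, fun σ K => ?_⟩
    · by_cases h : K = 0
      · rw [h]; rfl
      · exact absurd (by rw [PCSeries.smul_apply, PCSeries.one_apply_ne h, mul_zero]) hK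
    · rw [PCSeries.smul_apply, PCSeries.smul_apply]
      by_cases h : K = 0
      · rw [h, Finsupp.equivMapDomain_zero]
      · rw [PCSeries.one_apply_ne h, PCSeries.one_apply_ne]
        intro h'
        apply h
        ext i
        have := DFunLike.congr_fun h' (σ i)
        simpa using this

/-- `QSym_A`: the series of bounded degree such that the coefficients of any two monomials with the
same associated sentence are equal. -/
def QSymA (A : Type*) : Submodule ℚ (PCSeries A) where
  carrier := {f | (∃ n : ℕ, ∀ K, f K ≠ 0 → K.size ≤ n) ∧
    ∀ K L : WSent A, flatten K = flatten L → f K = f L}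
  add_mem' := by
    rintro f g ⟨⟨n, hn⟩, hf⟩ ⟨⟨m, hm⟩, hg⟩
    refine ⟨⟨max n m, fun K hK => ?_⟩, fun K L h => ?_⟩
    · by_cases h : f K = 0
      · refine (hm K fun h' => hK ?_).trans (le_max_right _ _)
        rw [PCSeries.add_apply, h, h', add_zero]
      · exact (hn K h).trans (le_max_left _ _)
    · rw [PCSeries.add_apply, PCSeries.add_apply, hf K L h, hg K L h]
  zero_mem' := ⟨⟨0, fun K hK => absurd rfl hK⟩, fun _ _ _ => rfl⟩
  smul_mem' := by
    rintro r f ⟨⟨n, hn⟩, hf⟩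
    refine ⟨⟨n, fun K hK => hn K fun h => hK ?_⟩, fun K L h => ?_⟩
    · rw [PCSeries.smul_apply, h, mul_zero]
    · rw [PCSeries.smul_apply, PCSeries.smul_apply, hf K L h]

theorem SymA.coeff_eq {A : Type*} [LinearOrder A] (f : SymA A) {K L : WSent A}
    (h : wsort K = wsort L) : f.1 K = f.1 L := by
  rw [wsort_eq_iff, ← (wsort_eq_iff L _).1 rfl] at h
  obtain ⟨σ, rfl⟩ := exists_perm_of_parts_eq K L h
  exact (f.2.2 σ K).symm

/-- The inclusion of `Sym_A` in `QSym_A`. -/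
def SymA.incl (A : Type*) [LinearOrder A] : SymA A →ₗ[ℚ] QSymA A where
  toFun f := ⟨f.1, f.2.1, fun _ _ h => SymA.coeff_eq f (congrArg sort h)⟩
  map_add' _ _ := rfl
  map_smul' _ _ := rfl

open Classical in
/-- The colored monomial quasisymmetric function `M_I`: the sum of all monomials with associated
sentence `I`. -/
def QSymA.monomial {A : Type*} (I : Sent A) : QSymA A :=
  ⟨fun K => if flatten K = I then 1 else 0, by
    refine ⟨⟨WSent.size (place I.1), fun K hK => le_of_eq ?_⟩, fun K L h => ?_⟩
    · have h : flatten K = I := by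
        by_contra h
        exact hK (if_neg h)
      rw [wsent_size_eq, wsent_size_eq, ← coe_entries K, ← coe_entries (place I.1),
        entries_place I.1 I.2, ← h]
      rfl
    · change ite _ _ _ = ite _ _ _
      rw [h]⟩

open Classical in
/-- The colored monomial symmetric function `m_P`: the sum of all monomials `x_K` for weak sentences
`K` with `sort(K) = P`. -/
def SymA.monomial {A : Type*} [LinearOrder A] (P : PSent A) : SymA A :=
  ⟨fun K => if wsort K = P then 1 else 0, by
    refine ⟨⟨WSent.size (place P.1), fun K hK => le_of_eq ?_⟩, fun σ K => ?_⟩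
    · have h : wsort K = P := by
        by_contra h
        exact hK (if_neg h)
      rw [wsent_size_eq, wsent_size_eq, (wsort_eq_iff K P).1 h,
        (wsort_eq_iff _ P).1 (wsort_place P)]
    · change ite _ _ _ = ite _ _ _
      simp only [wsort_eq_iff, parts_equivMapDomain]⟩

/-- The basis of the `M_I` of `QSym_A`. -/
def QSymA.basis (A : Type*) [Finite A] : Module.Basis (Sent A) ℚ (QSymA A) :=
  basisOfKey (X := WSent A) (QSymA A).subtype Subtype.val_injective flatten (fun I => place I.1)
    flatten_place QSymA.monomial
    (fun I => ⟨if_pos (flatten_place I), fun _ h => if_neg h⟩)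
    (fun f K => f.2.2 _ _ (flatten_place _).symm)
    (fun f => by
      obtain ⟨n, hn⟩ := f.2.1
      refine (finite_sent_size_le n).subset fun I hI => ?_
      have := hn _ hI
      rwa [wsent_size_place] at this)

theorem QSymA.basis_apply {A : Type*} [Finite A] (I : Sent A) :
    QSymA.basis A I = QSymA.monomial I := basisOfKey_apply _ _ _ _ _ _ _ _ _ _

/-- The basis of the `m_P` of `Sym_A`. -/
def SymA.basis (A : Type*) [Finite A] [LinearOrder A] : Module.Basis (PSent A) ℚ (SymA A) :=
  basisOfKey (X := WSent A) (Subalgebra.toSubmodule (SymA A)).subtype Subtype.val_injective wsort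
    (fun P => place P.1) wsort_place SymA.monomial
    (fun P => ⟨if_pos (wsort_place P), fun _ h => if_neg h⟩)
    (fun f _ => SymA.coeff_eq f (wsort_place _).symm)
    (fun f => by
      obtain ⟨n, hn⟩ := f.2.1
      refine Set.Finite.of_finite_image (f := PSent.toSent)
        ((finite_sent_size_le n).subset ?_) (fun P _ Q _ h => Subtype.ext (congrArg (fun I : Sent A => I.1) h))
      rintro _ ⟨P, hP, rfl⟩
      have := hn _ hP
      rwa [show (place P.1 : WSent A) = place P.toSent.1 from rfl, wsent_size_place] at this)

theorem SymA.basis_apply {A : Type*} [Finite A] [LinearOrder A] (P : PSent A) :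
    SymA.basis A P = SymA.monomial P := basisOfKey_apply _ _ _ _ _ _ _ _ _ _

/-! ### The coalgebra structures -/

/-- The first `i` words of a sentence. -/
def Sent.take {A : Type*} (I : Sent A) (i : ℕ) : Sent A :=
  ⟨I.1.take i, fun h => I.2 (List.mem_of_mem_take h)⟩

/-- The sentence without its first `i` words. -/
def Sent.drop {A : Type*} (I : Sent A) (i : ℕ) : Sent A :=
  ⟨I.1.drop i, fun h => I.2 (List.mem_of_mem_drop h)⟩

/-- The comultiplication of `QSym_A`: `Δ(M_I)` is the sum of `M_J ⊗ M_K` over `I = J · K`. -/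
def QSymA.comul (A : Type*) [Finite A] : QSymA A →ₗ[ℚ] QSymA A ⊗[ℚ] QSymA A :=
  (QSymA.basis A).constr ℚ fun I => ∑ i ∈ Finset.range (I.1.length + 1),
    QSymA.monomial (I.take i) ⊗ₜ[ℚ] QSymA.monomial (I.drop i)

theorem finite_sort_eq {A : Type*} [LinearOrder A] (P : PSent A) :
    {I : Sent A | sort I = P}.Finite := by
  classical
  refine Set.Finite.of_finite_image (f := Subtype.val)
    ((P.1.permutations.toFinset.finite_toSet).subset ?_) Subtype.val_injective.injOn
  rintro _ ⟨I, hI, rfl⟩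
  simpa using Multiset.coe_eq_coe.1 ((sort_eq_iff I P).1 hI)

theorem SymA.incl_monomial {A : Type*} [LinearOrder A] (P : PSent A) :
    SymA.incl A (SymA.monomial P) = ∑ I ∈ (finite_sort_eq P).toFinset, QSymA.monomial I := by
  classical
  apply Subtype.ext
  funext K
  have h1 : (SymA.incl A (SymA.monomial P)).1 K = if wsort K = P then 1 else 0 := by
    simp only [SymA.incl, SymA.monomial, LinearMap.coe_mk, AddHom.coe_mk]
  have h2 : ((∑ I ∈ (finite_sort_eq P).toFinset, QSymA.monomial I : QSymA A) : PCSeries A) K =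
      ∑ I ∈ (finite_sort_eq P).toFinset, if flatten K = I then 1 else 0 := by
    rw [AddSubmonoidClass.coe_finsetSum]
    refine (Finset.sum_apply (M := fun _ : WSent A => ℚ) K _ _).trans
      (Finset.sum_congr rfl fun I _ => ?_)
    simp only [QSymA.monomial]
  rw [h1, h2, Finset.sum_ite_eq]
  simp only [Set.Finite.mem_toFinset, Set.mem_ofPred_eq, wsort]
  congr

/-- The ordered pairs of sentences whose concatenation sorts to `P`. -/
theorem finite_concat_sort_eq {A : Type*} [LinearOrder A] (P : PSent A) :
    {p : Sent A × Sent A | sort (p.1.concat p.2) = P}.Finite := by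
  have := (Set.finite_Iic P.1.length)
  refine ((((finite_sort_eq P).prod this)).image
    (fun q : Sent A × ℕ => (q.1.take q.2, q.1.drop q.2))).subset ?_
  rintro ⟨J, K⟩ h
  refine ⟨(J.concat K, J.1.length), ⟨h, ?_⟩, ?_⟩
  · have hc := congrArg Multiset.card ((sort_eq_iff _ _).1 h)
    simp only [Sent.concat, Multiset.coe_card, List.length_append] at hc
    simp only [Set.mem_Iic]
    omega
  · simp [Sent.concat, Sent.take, Sent.drop]

theorem comul_incl_monomial {A : Type*} [Finite A] [LinearOrder A] (P : PSent A) :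
    QSymA.comul A (SymA.incl A (SymA.monomial P)) =
      ∑ p ∈ (finite_concat_sort_eq P).toFinset,
        QSymA.monomial p.1 ⊗ₜ[ℚ] QSymA.monomial p.2 := by
  rw [SymA.incl_monomial, map_sum]
  simp only [← QSymA.basis_apply, QSymA.comul, Module.Basis.constr_basis]
  rw [Finset.sum_sigma']
  refine Finset.sum_bij' (fun q _ => (q.1.take q.2, q.1.drop q.2))
    (fun p _ => ⟨p.1.concat p.2, p.1.1.length⟩) ?_ ?_ ?_ ?_ ?_
  · rintro ⟨I, i⟩ h
    simp only [Finset.mem_sigma, Set.Finite.mem_toFinset, Set.mem_ofPred_eq] at h ⊢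
    have hI : (I.take i).concat (I.drop i) = I := Subtype.ext (List.take_append_drop i I.1)
    rw [hI]
    exact h.1
  · rintro ⟨J, K⟩ h
    simp only [Finset.mem_sigma, Set.Finite.mem_toFinset, Set.mem_ofPred_eq] at h ⊢
    refine ⟨h, ?_⟩
    simp only [Sent.concat, List.length_append, Finset.mem_range]
    omega
  · rintro ⟨I, i⟩ h
    simp only [Finset.mem_sigma, Finset.mem_range] at h
    have hI : (I.take i).concat (I.drop i) = I := Subtype.ext (List.take_append_drop i I.1)
    have hi : (I.take i).1.length = i := by
      simp only [Sent.take, List.length_take]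
      omega
    simp only [hI, hi]
  · rintro ⟨J, K⟩ h
    simp [Sent.concat, Sent.take, Sent.drop]
  · rintro ⟨I, i⟩ h
    rfl

theorem comul_incl_mem {A : Type*} [Finite A] [LinearOrder A] (f : SymA A) :
    (QSymA.comul A ∘ₗ SymA.incl A) f ∈
      LinearMap.range (TensorProduct.map (SymA.incl A) (SymA.incl A)) := by
  classical
  have hspan : f ∈ Submodule.span ℚ (Set.range (SymA.basis A)) := (SymA.basis A).mem_span f
  induction hspan using Submodule.span_induction with
  | zero => rw [map_zero]; exact Submodule.zero_mem _
  | add f g _ _ hf hg => rw [map_add]; exact Submodule.add_mem _ hf hg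
  | smul r f _ hf => rw [map_smul]; exact Submodule.smul_mem _ _ hf
  | mem f hf =>
    obtain ⟨P, rfl⟩ := hf
    rw [LinearMap.comp_apply, SymA.basis_apply, comul_incl_monomial]
    rw [← Finset.sum_fiberwise_of_maps_to (g := fun p => (sort p.1, sort p.2))
      (fun p hp => Finset.mem_image_of_mem _ hp)]
    refine Submodule.sum_mem _ fun q hq => ?_
    refine ⟨SymA.monomial q.1 ⊗ₜ SymA.monomial q.2, ?_⟩
    rw [TensorProduct.map_tmul, SymA.incl_monomial, SymA.incl_monomial, TensorProduct.sum_tmul]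
    simp only [TensorProduct.tmul_sum]
    rw [← Finset.sum_product']
    refine Finset.sum_congr ?_ fun _ _ => rfl
    ext ⟨J, K⟩
    simp only [Finset.mem_product, Set.Finite.mem_toFinset, Set.mem_ofPred_eq, Finset.mem_filter,
      Prod.ext_iff]
    refine ⟨fun h => ⟨?_, h⟩, fun h => h.2⟩
    obtain ⟨⟨J', K'⟩, h', rfl⟩ := Finset.mem_image.1 hq
    simp only [Set.Finite.mem_toFinset, Set.mem_ofPred_eq] at h'
    rw [← h', sort_eq_iff, coe_sort]
    simp only [Sent.concat, ← Multiset.coe_add]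
    rw [(sort_eq_iff _ _).1 h.1, (sort_eq_iff _ _).1 h.2, coe_sort, coe_sort]

theorem map_incl_injective (A : Type*) [LinearOrder A] :
    Function.Injective (TensorProduct.map (SymA.incl A) (SymA.incl A)) := by
  have h : Function.Injective (SymA.incl A) := fun f g h =>
    Subtype.ext (congrArg (fun q : QSymA A => q.1) h)
  exact TensorProduct.map_injective_of_flat_flat _ _ h h

/-- The comultiplication of `Sym_A`: the restriction of the comultiplication of `QSym_A`, that is,
the map `Δ` with `(ι ⊗ ι) ∘ Δ = Δ_{QSym_A} ∘ ι` for the inclusion `ι`. -/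
def SymA.comul (A : Type*) [Finite A] [LinearOrder A] : SymA A →ₗ[ℚ] SymA A ⊗[ℚ] SymA A :=
  (LinearEquiv.ofInjective _ (map_incl_injective A)).symm.toLinearMap ∘ₗ
    (QSymA.comul A ∘ₗ SymA.incl A).codRestrict _ comul_incl_mem

theorem SymA.map_incl_comul {A : Type*} [Finite A] [LinearOrder A] (f : SymA A) :
    TensorProduct.map (SymA.incl A) (SymA.incl A) (SymA.comul A f) =
      QSymA.comul A (SymA.incl A f) :=
  congrArg Subtype.val ((LinearEquiv.ofInjective _ (map_incl_injective A)).apply_symm_apply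
    ((QSymA.comul A ∘ₗ SymA.incl A).codRestrict _ comul_incl_mem f))

/-- The counit of `Sym_A` sends a series to its constant coefficient. -/
instance SymA.coalgebraStruct (A : Type*) [Finite A] [LinearOrder A] :
    CoalgebraStruct ℚ (SymA A) where
  comul := SymA.comul A
  counit :=
    { toFun := fun f => f.1 0
      map_add' := fun _ _ => rfl
      map_smul' := fun _ _ => rfl }

/-! ### Symmetric functions -/

/-- Partitions of all natural numbers. -/
abbrev Ptn := Σ n : ℕ, n.Partition

/-- The partition whose parts are the nonzero elements of a multiset. -/
def ptn (s : Multiset ℕ) : Ptn := ⟨s.sum, Nat.Partition.ofMultiset s⟩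

/-- The partition formed by the nonzero entries of an exponent sequence. -/
def shape (α : ℕ →₀ ℕ) : Ptn := ptn (parts α)

/-- The parts of a partition, in weakly decreasing order. -/
def Ptn.toList (l : Ptn) : List ℕ := l.2.parts.sort (· ≥ ·)

theorem ptn_ext {l m : Ptn} (h : l.2.parts = m.2.parts) : l = m := by
  obtain ⟨n, p, hp, rfl⟩ := l
  obtain ⟨k, q, hq, rfl⟩ := m
  obtain rfl : p = q := h
  rfl

theorem shape_parts (α : ℕ →₀ ℕ) : (shape α).2.parts = parts α := by
  change (parts α).filter _ = _
  rw [Multiset.filter_eq_self, ← coe_entries]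
  exact fun a ha h => zero_notMem_entries α (h ▸ ha)

theorem shape_eq_iff (α : ℕ →₀ ℕ) (l : Ptn) : shape α = l ↔ parts α = l.2.parts := by
  rw [← shape_parts]
  exact ⟨fun h => h ▸ rfl, ptn_ext⟩

theorem shape_place (l : Ptn) : shape (place l.toList) = l := by
  rw [shape_eq_iff, ← coe_entries, entries_place, Ptn.toList, Multiset.sort_eq]
  intro h
  rw [Ptn.toList, Multiset.mem_sort] at h
  exact absurd (l.2.parts_pos h) (lt_irrefl 0)

theorem degree_eq (α : ℕ →₀ ℕ) : α.degree = (shape α).1 := rfl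

/-- `Sym`: the formal power series of bounded degree in `x₀, x₁, …` with rational coefficients that
are invariant under all permutations of the variables. -/
def Sym : Subalgebra ℚ (MvPowerSeries ℕ ℚ) where
  carrier := {f | (∃ n : ℕ, ∀ α, MvPowerSeries.coeff α f ≠ 0 → α.degree ≤ n) ∧
    ∀ (σ : Equiv.Perm ℕ) (α : ℕ →₀ ℕ),
      MvPowerSeries.coeff (α.equivMapDomain σ) f = MvPowerSeries.coeff α f}
  add_mem' := by
    rintro f g ⟨⟨n, hn⟩, hf⟩ ⟨⟨m, hm⟩, hg⟩
    refine ⟨⟨max n m, fun α hα => ?_⟩, fun σ α => ?_⟩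
    · by_cases h : MvPowerSeries.coeff α f = 0
      · refine (hm α fun h' => hα ?_).trans (le_max_right _ _)
        rw [map_add, h, h', add_zero]
      · exact (hn α h).trans (le_max_left _ _)
    · rw [map_add, map_add, hf, hg]
  mul_mem' := by
    classical
    rintro f g ⟨⟨n, hn⟩, hf⟩ ⟨⟨m, hm⟩, hg⟩
    refine ⟨⟨n + m, fun α hα => ?_⟩, fun σ α => ?_⟩
    · rw [MvPowerSeries.coeff_mul] at hα
      obtain ⟨p, hp, h⟩ := Finset.exists_ne_zero_of_sum_ne_zero hα
      rw [Finset.HasAntidiagonal.mem_antidiagonal] at hp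
      rw [← hp, map_add]
      exact add_le_add (hn _ (left_ne_zero_of_mul h)) (hm _ (right_ne_zero_of_mul h))
    · rw [MvPowerSeries.coeff_mul, MvPowerSeries.coeff_mul]
      symm
      refine Finset.sum_nbij'
        (fun p => (p.1.equivMapDomain σ, p.2.equivMapDomain σ))
        (fun p => (p.1.equivMapDomain σ.symm, p.2.equivMapDomain σ.symm)) ?_ ?_ ?_ ?_ ?_
      · intro p hp
        rw [Finset.HasAntidiagonal.mem_antidiagonal] at hp ⊢
        rw [← hp]
        ext i; rfl
      · intro p hp
        rw [Finset.HasAntidiagonal.mem_antidiagonal] at hp ⊢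
        ext i
        have := DFunLike.congr_fun hp (σ i)
        simpa using this
      · intro p _
        ext i <;> simp
      · intro p _
        ext i <;> simp
      · intro p _
        simp only [hf, hg]
  algebraMap_mem' := by
    classical
    intro r
    rw [Algebra.algebraMap_eq_smul_one]
    refine ⟨⟨0, fun α hα => ?_⟩, fun σ α => ?_⟩
    · by_cases h : α = 0
      · simp [h]
      · exact absurd (by simp [MvPowerSeries.coeff_one, h]) hα
    · have : α.equivMapDomain σ = 0 ↔ α = 0 := by
        refine ⟨fun h' => ?_, fun h => by rw [h, Finsupp.equivMapDomain_zero]⟩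
        ext i
        have := DFunLike.congr_fun h' (σ i)
        simpa using this
      simp [MvPowerSeries.coeff_one, this]

theorem Sym.coeff_eq (f : Sym) {α β : ℕ →₀ ℕ} (h : shape α = shape β) :
    MvPowerSeries.coeff α f.1 = MvPowerSeries.coeff β f.1 := by
  rw [shape_eq_iff, shape_parts] at h
  obtain ⟨σ, rfl⟩ := exists_perm_of_parts_eq α β h
  exact (f.2.2 σ α).symm

open Classical in
/-- The monomial symmetric function `m_λ`: the sum of all monomials whose nonzero exponents are the
parts of `λ`. -/
def Sym.monomial (l : Ptn) : Sym :=
  ⟨fun α => if shape α = l then 1 else 0, by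
    refine ⟨⟨l.1, fun α hα => ?_⟩, fun σ α => ?_⟩
    · have h : shape α = l := by
        by_contra h
        exact hα (if_neg h)
      rw [degree_eq, h]
    · change ite _ _ _ = ite _ _ _
      simp only [shape_eq_iff, parts_equivMapDomain]⟩

/-- The basis of the `m_λ` of `Sym`. -/
def Sym.basis : Module.Basis Ptn ℚ Sym :=
  basisOfKey (X := ℕ →₀ ℕ) (Subalgebra.toSubmodule Sym).subtype Subtype.val_injective shape
    (fun l => place l.toList) shape_place Sym.monomial
    (fun l => ⟨if_pos (shape_place l), fun _ h => if_neg h⟩)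
    (fun f _ => Sym.coeff_eq f (shape_place _).symm)
    (fun f => by
      obtain ⟨n, hn⟩ := f.2.1
      have hfin : (⋃ k ∈ Set.Iic n, Set.range (Sigma.mk k : k.Partition → Ptn)).Finite :=
        (Set.finite_Iic n).biUnion fun k _ => Set.finite_range _
      refine hfin.subset fun l hl => ?_
      have := hn _ hl
      rw [degree_eq, shape_place] at this
      simp only [Set.mem_iUnion]
      exact ⟨l.1, this, l.2, rfl⟩)

theorem Sym.basis_apply (l : Ptn) : Sym.basis l = Sym.monomial l :=
  basisOfKey_apply _ _ _ _ _ _ _ _ _ _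

theorem finite_union_eq (l : Ptn) :
    {p : Ptn × Ptn | p.1.2.parts + p.2.2.parts = l.2.parts}.Finite := by
  classical
  refine Set.Finite.of_finite_image (f := fun p : Ptn × Ptn => (p.1.2.parts, p.2.2.parts))
    (((Multiset.antidiagonal l.2.parts).toFinset.finite_toSet).subset ?_) ?_
  · rintro _ ⟨p, hp, rfl⟩
    simpa using hp
  · intro p _ q _ h
    exact Prod.ext (ptn_ext (Prod.ext_iff.1 h).1) (ptn_ext (Prod.ext_iff.1 h).2)

/-- The ordered pairs `(μ, ν)` of partitions whose multiset union is `λ`. -/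
def unionPairs (l : Ptn) : Finset (Ptn × Ptn) := (finite_union_eq l).toFinset

/-- The comultiplication of `Sym` is `Δ(m_λ) = ∑ m_μ ⊗ m_ν` over the pairs `(μ, ν)` of partitions
with union `λ`; the counit sends a series to its constant coefficient. -/
instance Sym.coalgebraStruct : CoalgebraStruct ℚ Sym where
  comul := Sym.basis.constr ℚ fun l => ∑ p ∈ unionPairs l,
    Sym.monomial p.1 ⊗ₜ[ℚ] Sym.monomial p.2
  counit :=
    { toFun := fun f => MvPowerSeries.coeff 0 f.1
      map_add' := fun _ _ => map_add _ _ _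
      map_smul' := fun _ _ => map_smul _ _ _ }

/-! ### The uncoloring map and the structure constants -/

/-- The partition of the word lengths of a p-sentence. -/
def wordLengths {A : Type*} [LinearOrder A] (P : PSent A) : Ptn :=
  ptn (P.1.map FreeAddMonoid.length : List ℕ)

/-- The uncoloring map `υ : Sym_A → Sym`, the linear map with `υ(m_P) = m_{wℓ(P)}`. -/
def uncolor (A : Type*) [Finite A] [LinearOrder A] : SymA A →ₗ[ℚ] Sym :=
  (SymA.basis A).constr ℚ fun P => Sym.monomial (wordLengths P)

/-- `r^Q_{P,S}`: the number of pairs of weak sentences `(Y, Z)` with `sort(Y) = P`, `sort(Z) = S` and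
`(y₁z₁, y₂z₂, …) = Q`. -/
def structConst {A : Type*} [LinearOrder A] (P S Q : PSent A) : ℕ :=
  Nat.card {p : WSent A × WSent A // wsort p.1 = P ∧ wsort p.2 = S ∧ p.1 + p.2 = place Q.1}

/-- `r^ν_{λ,μ}`: the number of pairs of sequences `(α, β)` of natural numbers with `sort(α) = λ`,
`sort(β) = μ` and `(α₁ + β₁, α₂ + β₂, …) = ν`. -/
def ptnStructConst (l m n : Ptn) : ℕ :=
  Nat.card {p : (ℕ →₀ ℕ) × (ℕ →₀ ℕ) // shape p.1 = l ∧ shape p.2 = m ∧ p.1 + p.2 = place n.toList}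

/-- `Q ⊑ P`: the words of `Q` form a submultiset of the words of `P`. -/
def SubSent {A : Type*} [LinearOrder A] (Q P : PSent A) : Prop :=
  (Q.1 : Multiset (Word A)) ≤ P.1

theorem finite_subSent {A : Type*} [LinearOrder A] (P : PSent A) :
    {Q : PSent A | SubSent Q P}.Finite := by
  classical
  refine Set.Finite.of_finite_image (f := fun Q : PSent A => (Q.1 : Multiset (Word A)))
    (((Multiset.powerset (P.1 : Multiset (Word A))).toFinset.finite_toSet).subset ?_)
    (fun _ _ _ _ h => psent_ext h)
  rintro _ ⟨Q, hQ, rfl⟩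
  exact Finset.mem_coe.2 (Multiset.mem_toFinset.2 (Multiset.mem_powerset.2 hQ))

/-- The finite set of the p-sentences `Q ⊑ P`. -/
def subSents {A : Type*} [LinearOrder A] (P : PSent A) : Finset (PSent A) :=
  (finite_subSent P).toFinset

open Classical in
/-- The p-sentence whose words are those of `P` with the words of `Q` removed (as multisets). -/
def PSent.diff {A : Type*} [LinearOrder A] (P Q : PSent A) : PSent A :=
  sort ⟨P.1.diff Q.1, fun h => P.2.1 ((List.diff_subset _ _) h)⟩

/-- The empty p-sentence. -/
def PSent.empty (A : Type*) [LinearOrder A] : PSent A := ⟨[], by simp⟩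

/-! ### Hopf algebras -/

/-- An algebra `B` with comultiplication `Δ` and counit `ε` is a Hopf algebra with antipode `S`. -/
structure IsHopfAlgebra (B : Type*) [Ring B] [Algebra ℚ B] [CoalgebraStruct ℚ B]
    (S : B →ₗ[ℚ] B) : Prop where
  coassoc : (TensorProduct.assoc ℚ B B B).toLinearMap ∘ₗ
      (CoalgebraStruct.comul (R := ℚ)).rTensor B ∘ₗ CoalgebraStruct.comul (R := ℚ) (A := B) =
    (CoalgebraStruct.comul (R := ℚ)).lTensor B ∘ₗ CoalgebraStruct.comul
  rTensor_counit_comp_comul : (CoalgebraStruct.counit (R := ℚ)).rTensor B ∘ₗ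
    CoalgebraStruct.comul (R := ℚ) (A := B) = TensorProduct.mk ℚ ℚ B 1
  lTensor_counit_comp_comul : (CoalgebraStruct.counit (R := ℚ)).lTensor B ∘ₗ
    CoalgebraStruct.comul (R := ℚ) (A := B) = (TensorProduct.mk ℚ B ℚ).flip 1
  counit_one : CoalgebraStruct.counit (R := ℚ) (1 : B) = 1
  counit_mul : ∀ a b : B, CoalgebraStruct.counit (R := ℚ) (a * b) =
    CoalgebraStruct.counit (R := ℚ) a * CoalgebraStruct.counit (R := ℚ) b
  comul_one : CoalgebraStruct.comul (R := ℚ) (1 : B) = 1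
  comul_mul : ∀ a b : B, CoalgebraStruct.comul (R := ℚ) (a * b) =
    CoalgebraStruct.comul (R := ℚ) a * CoalgebraStruct.comul (R := ℚ) b
  mul_antipode_rTensor_comul : LinearMap.mul' ℚ B ∘ₗ S.rTensor B ∘ₗ CoalgebraStruct.comul =
    Algebra.linearMap ℚ B ∘ₗ CoalgebraStruct.counit
  mul_antipode_lTensor_comul : LinearMap.mul' ℚ B ∘ₗ S.lTensor B ∘ₗ CoalgebraStruct.comul =
    Algebra.linearMap ℚ B ∘ₗ CoalgebraStruct.counit

/-- The Hopf algebra of Mathlib given by `IsHopfAlgebra`. -/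
abbrev IsHopfAlgebra.toHopfAlgebra {B : Type*} [Ring B] [Algebra ℚ B] [CoalgebraStruct ℚ B]
    {S : B →ₗ[ℚ] B} (h : IsHopfAlgebra B S) : HopfAlgebra ℚ B :=
  letI : Coalgebra ℚ B :=
    { coassoc := h.coassoc
      rTensor_counit_comp_comul := h.rTensor_counit_comp_comul
      lTensor_counit_comp_comul := h.lTensor_counit_comp_comul }
  letI : Bialgebra ℚ B := Bialgebra.mk' ℚ B h.counit_one (h.counit_mul _ _) h.comul_one
    (h.comul_mul _ _)
  { antipode := S
    mul_antipode_rTensor_comul := h.mul_antipode_rTensor_comul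
    mul_antipode_lTensor_comul := h.mul_antipode_lTensor_comul }

end

end ColoredSym

namespace ColoredSym

noncomputable section

/-! ### Symmetric functions as a Hopf algebra -/

/-! Over a one-letter alphabet a word is its length. Reading lengths entry by entry is an additive
bijection from weak sentences to exponent sequences (`lengthsEquiv`), and it turns sorting into
taking the shape (`shape_lengthsEquiv`). So p-sentences become partitions, and uncoloring merely
renames the monomials of a series: the coefficient of `x_K` is unchanged (`coeff_uncolor`).
Products, counits and structure constants therefore agree. The coproducts agree because splitting
the words of `P` into `Q` and the rest is splitting the partition `wℓ(P)` into two parts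
(`mem_unionPairs_wordLengths`).

It remains to see that `Sym` is a Hopf algebra. The coproduct is substitution of a doubled set of
variables: the coefficient of `x^α ⊗ x^β` in `Δ f` is the coefficient in `f` of the interleaved
exponent `join (α, β)` (`Sym.coeff₂_comul`). Since coefficients of `f` depend only on the multiset
of nonzero exponents, and `join` is an additive bijection under which these multisets add, the
axioms for the coproduct become statements about sums of multisets and about antidiagonals. The
antipode is found by recursion on the number of parts, and is two-sided because `Sym` is commutative
and cocommutative.

The Hopf structure of `Sym_A` is then transported along the uncoloring isomorphism
(`IsHopfAlgebra.of_equiv`). Its antipode is the conjugate of that of `Sym`, so uncoloring commutes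
with the antipodes. The product and coproduct rules for the `m_P` hold over every finite alphabet:
the first by reading off coefficients, the second by comparison inside `QSym_A ⊗ QSym_A`. -/

/-- Two exponent sequences, interleaved into one. -/
def join : (ℕ →₀ ℕ) × (ℕ →₀ ℕ) ≃+ (ℕ →₀ ℕ) :=
  Finsupp.sumFinsuppAddEquivProdFinsupp.symm.trans (Finsupp.domCongr Equiv.natSumNatEquivNat)

/-- The entries of `α` and `β` land in complementary sets of positions. Besides being an additive
bijection, this is all that is used about `join`. -/
theorem parts_join (α β : ℕ →₀ ℕ) : parts (join (α, β)) = parts α + parts β := by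
  classical
  have hs : (join (α, β)).support =
      (α.support.disjSum β.support).map Equiv.natSumNatEquivNat.toEmbedding := by
    ext i
    obtain ⟨j, rfl⟩ := Equiv.natSumNatEquivNat.surjective i
    rw [Finset.mem_map_equiv, Equiv.symm_apply_apply, Finsupp.mem_support_iff]
    rcases j with j | j <;> simp [join, -Equiv.natSumNatEquivNat_apply]
  rw [parts, hs]
  simp only [Finset.map_val, Finset.val_disjSum, Multiset.disjSum, Multiset.map_add,
    Multiset.map_map]
  congr 1 <;> refine Multiset.map_congr rfl fun i _ => ?_ <;>
    simp [join, -Equiv.natSumNatEquivNat_apply]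

theorem shape_join_eq_iff (α β : ℕ →₀ ℕ) (l : Ptn) :
    shape (join (α, β)) = l ↔ (shape α, shape β) ∈ unionPairs l := by
  simp [shape_eq_iff, parts_join, unionPairs, shape_parts]

/-! ### Coefficient functionals on `Sym` and its tensor powers -/

/-- The coefficient of `x^α` in a symmetric function. -/
def Sym.coeff (α : ℕ →₀ ℕ) : Sym →ₗ[ℚ] ℚ where
  toFun f := MvPowerSeries.coeff α f.1
  map_add' _ _ := map_add _ _ _
  map_smul' _ _ := map_smul _ _ _

theorem Sym.ext_coeff {f g : Sym} (h : ∀ α, Sym.coeff α f = Sym.coeff α g) : f = g :=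
  Subtype.ext (MvPowerSeries.ext h)

open Classical in
theorem Sym.coeff_monomial (α : ℕ →₀ ℕ) (l : Ptn) :
    Sym.coeff α (Sym.monomial l) = if shape α = l then 1 else 0 := rfl

theorem Sym.coeff_mul (α : ℕ →₀ ℕ) (f g : Sym) : Sym.coeff α (f * g) =
    ∑ p ∈ Finset.HasAntidiagonal.antidiagonal α, Sym.coeff p.1 f * Sym.coeff p.2 g := by
  classical
  exact MvPowerSeries.coeff_mul _ _ _

open Classical in
theorem Sym.coeff_one (α : ℕ →₀ ℕ) : Sym.coeff α 1 = if α = 0 then 1 else 0 :=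
  MvPowerSeries.coeff_one _

theorem Sym.coeff_congr {α β : ℕ →₀ ℕ} (h : parts α = parts β) (f : Sym) :
    Sym.coeff α f = Sym.coeff β f :=
  Sym.coeff_eq f ((shape_eq_iff _ _).2 (h.trans (shape_parts _).symm))

theorem Sym.basis_repr_apply (f : Sym) (l : Ptn) :
    Sym.basis.repr f l = Sym.coeff (place l.toList) f := rfl

theorem Sym.hom_ext {M : Type*} [AddCommGroup M] [Module ℚ M] {φ ψ : Sym →ₗ[ℚ] M}
    (h : ∀ l, φ (Sym.monomial l) = ψ (Sym.monomial l)) : φ = ψ :=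
  Sym.basis.ext fun l => by rw [Sym.basis_apply, h]

/-- The coefficient of `x^α ⊗ x^β` in a tensor. -/
def Sym.coeff₂ (α β : ℕ →₀ ℕ) : Sym ⊗[ℚ] Sym →ₗ[ℚ] ℚ :=
  LinearMap.mul' ℚ ℚ ∘ₗ TensorProduct.map (Sym.coeff α) (Sym.coeff β)

@[simp]
theorem Sym.coeff₂_tmul (α β : ℕ →₀ ℕ) (f g : Sym) :
    Sym.coeff₂ α β (f ⊗ₜ g) = Sym.coeff α f * Sym.coeff β g := rfl

/-- The coefficient of `x^α ⊗ x^β ⊗ x^γ` in a tensor. -/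
def Sym.coeff₃ (α β γ : ℕ →₀ ℕ) : Sym ⊗[ℚ] (Sym ⊗[ℚ] Sym) →ₗ[ℚ] ℚ :=
  LinearMap.mul' ℚ ℚ ∘ₗ TensorProduct.map (Sym.coeff α) (Sym.coeff₂ β γ)

@[simp]
theorem Sym.coeff₃_tmul (α β γ : ℕ →₀ ℕ) (f : Sym) (t : Sym ⊗[ℚ] Sym) :
    Sym.coeff₃ α β γ (f ⊗ₜ t) = Sym.coeff α f * Sym.coeff₂ β γ t := rfl

theorem Sym.basis_tensor_repr (t : Sym ⊗[ℚ] Sym) (l m : Ptn) :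
    (Sym.basis.tensorProduct Sym.basis).repr t (l, m) =
      Sym.coeff₂ (place l.toList) (place m.toList) t := by
  induction t with
  | zero => simp
  | add t u ht hu => simp [ht, hu]
  | tmul f g =>
    simp [Module.Basis.tensorProduct_repr_tmul_apply, Sym.basis_repr_apply, mul_comm]

/-- Among these functionals are the coordinates in the basis `m_λ ⊗ m_μ`, so they separate tensors;
identities in `Sym ⊗ Sym` can be checked coefficient by coefficient. -/
theorem Sym.ext_coeff₂ {t u : Sym ⊗[ℚ] Sym}
    (h : ∀ α β, Sym.coeff₂ α β t = Sym.coeff₂ α β u) : t = u :=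
  (Sym.basis.tensorProduct Sym.basis).ext_elem fun p => by
    rw [Sym.basis_tensor_repr, Sym.basis_tensor_repr, h]

set_option synthInstance.maxHeartbeats 200000 in
theorem Sym.ext_coeff₃ {t u : Sym ⊗[ℚ] (Sym ⊗[ℚ] Sym)}
    (h : ∀ α β γ, Sym.coeff₃ α β γ t = Sym.coeff₃ α β γ u) : t = u := by
  refine (Sym.basis.tensorProduct (Sym.basis.tensorProduct Sym.basis)).ext_elem ?_
  rintro ⟨l, m, n⟩
  have key : ∀ t, (Sym.basis.tensorProduct (Sym.basis.tensorProduct Sym.basis)).repr t (l, m, n) =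
      Sym.coeff₃ (place l.toList) (place m.toList) (place n.toList) t := by
    intro t
    induction t with
    | zero => simp
    | add t u ht hu => simp [ht, hu]
    | tmul f g =>
      simp [Module.Basis.tensorProduct_repr_tmul_apply, Sym.basis_repr_apply,
        Sym.basis_tensor_repr, mul_comm]
  rw [key, key, h]

/-! ### The bialgebra axioms, coefficient by coefficient -/

theorem Sym.comul_monomial (l : Ptn) : CoalgebraStruct.comul (R := ℚ) (Sym.monomial l) =
    ∑ p ∈ unionPairs l, Sym.monomial p.1 ⊗ₜ[ℚ] Sym.monomial p.2 := by
  rw [← Sym.basis_apply]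
  exact Sym.basis.constr_basis ℚ _ l

theorem Sym.counit_apply (f : Sym) : CoalgebraStruct.counit (R := ℚ) f = Sym.coeff 0 f := rfl

/-- On `m_λ` both sides are the indicator of the condition that the shapes of `α` and `β` have union
`λ`. All later statements about the coproduct of `Sym` as a linear map, up to cocommutativity, go
through this formula. -/
theorem Sym.coeff₂_comul (α β : ℕ →₀ ℕ) (f : Sym) :
    Sym.coeff₂ α β (CoalgebraStruct.comul (R := ℚ) f) = Sym.coeff (join (α, β)) f := by
  classical
  have : Sym.coeff₂ α β ∘ₗ CoalgebraStruct.comul (R := ℚ) = Sym.coeff (join (α, β)) := by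
    refine Sym.hom_ext fun l => ?_
    rw [LinearMap.comp_apply, Sym.comul_monomial, map_sum, Sym.coeff_monomial]
    simp only [shape_join_eq_iff, Sym.coeff₂_tmul, Sym.coeff_monomial]
    -- The indicator of membership is spread out as a sum of Kronecker deltas, to be matched term by
    -- term.
    rw [← Finset.sum_ite_eq (unionPairs l) (shape α, shape β) fun _ => (1 : ℚ)]
    refine Finset.sum_congr rfl fun p _ => ?_
    simp only [Prod.ext_iff, ite_and, ite_mul, one_mul, zero_mul]
  exact congr($this f)

theorem Sym.coeff₂_mul (α β : ℕ →₀ ℕ) (t u : Sym ⊗[ℚ] Sym) : Sym.coeff₂ α β (t * u) =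
    ∑ p ∈ Finset.HasAntidiagonal.antidiagonal α, ∑ q ∈ Finset.HasAntidiagonal.antidiagonal β,
      Sym.coeff₂ p.1 q.1 t * Sym.coeff₂ p.2 q.2 u := by
  induction t with
  | zero => simp
  | add t t' ht ht' => simp only [add_mul, map_add, ht, ht', Finset.sum_add_distrib]
  | tmul f g =>
    induction u with
    | zero => simp
    | add u u' hu hu' => simp only [mul_add, map_add, hu, hu', Finset.sum_add_distrib]
    | tmul f' g' =>
      simp only [Algebra.TensorProduct.tmul_mul_tmul, Sym.coeff₂_tmul, Sym.coeff_mul,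
        Finset.sum_mul_sum]
      exact Finset.sum_congr rfl fun _ _ => Finset.sum_congr rfl fun _ _ => by ring

/-- Because `join` is an additive bijection, the decompositions of `join (α, β)` are the pairs of a
decomposition of `α` and one of `β`. -/
theorem Sym.comul_mul (f g : Sym) : CoalgebraStruct.comul (R := ℚ) (f * g) =
    CoalgebraStruct.comul (R := ℚ) f * CoalgebraStruct.comul (R := ℚ) g := by
  refine Sym.ext_coeff₂ fun α β => ?_
  rw [Sym.coeff₂_comul, Sym.coeff_mul, Sym.coeff₂_mul, ← Finset.sum_product']
  simp only [Sym.coeff₂_comul]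
  symm
  refine Finset.sum_bij' (fun q _ => (join (q.1.1, q.2.1), join (q.1.2, q.2.2)))
    (fun p _ => (((join.symm p.1).1, (join.symm p.2).1), ((join.symm p.1).2, (join.symm p.2).2)))
    ?_ ?_ ?_ ?_ ?_
  · rintro ⟨⟨a, b⟩, ⟨c, d⟩⟩ h
    simp only [Finset.mem_product, Finset.HasAntidiagonal.mem_antidiagonal] at h ⊢
    rw [← map_add, Prod.mk_add_mk, h.1, h.2]
  · rintro ⟨a, b⟩ h
    simp only [Finset.mem_product, Finset.HasAntidiagonal.mem_antidiagonal] at h ⊢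
    rw [← Prod.fst_add, ← Prod.snd_add, ← map_add, h, AddEquiv.symm_apply_apply]
    exact ⟨rfl, rfl⟩
  · rintro ⟨⟨a, b⟩, ⟨c, d⟩⟩ _
    simp
  · rintro ⟨a, b⟩ _
    simp
  · intro _ _
    rfl

theorem Sym.comul_one : CoalgebraStruct.comul (R := ℚ) (1 : Sym) = 1 := by
  classical
  refine Sym.ext_coeff₂ fun α β => ?_
  rw [Sym.coeff₂_comul, Algebra.TensorProduct.one_def, Sym.coeff₂_tmul]
  simp only [Sym.coeff_one, EmbeddingLike.map_eq_zero_iff, Prod.mk_eq_zero, ite_and, ite_mul,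
    one_mul, zero_mul]

/-- The two sides read the coefficients of `f` at `join (join (α, β), γ)` and `join (α, join (β,
γ))`. These sequences need not coincide, but they have the same nonzero entries, and `f` is
symmetric. -/
theorem Sym.coassoc : (TensorProduct.assoc ℚ Sym Sym Sym).toLinearMap ∘ₗ
      (CoalgebraStruct.comul (R := ℚ)).rTensor Sym ∘ₗ CoalgebraStruct.comul (R := ℚ) (A := Sym) =
    (CoalgebraStruct.comul (R := ℚ)).lTensor Sym ∘ₗ CoalgebraStruct.comul := by
  refine LinearMap.ext fun f => Sym.ext_coeff₃ fun α β γ => ?_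
  have h₁ : ∀ t : Sym ⊗[ℚ] Sym, Sym.coeff₃ α β γ (TensorProduct.assoc ℚ Sym Sym Sym
      ((CoalgebraStruct.comul (R := ℚ)).rTensor Sym t)) = Sym.coeff₂ (join (α, β)) γ t := by
    intro t
    induction t with
    | zero => simp
    | add t u ht hu => simp only [map_add, ht, hu]
    | tmul f g =>
      rw [LinearMap.rTensor_tmul, Sym.coeff₂_tmul, ← Sym.coeff₂_comul]
      -- The identity holds for any tensor in place of the coproduct of `f`, so it may be checked on
      -- pure tensors.
      generalize CoalgebraStruct.comul (R := ℚ) f = t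
      induction t with
      | zero => simp
      | add t u ht hu => simp only [TensorProduct.add_tmul, map_add, ht, hu, add_mul]
      | tmul f' g' => simp [mul_assoc]
  have h₂ : ∀ t : Sym ⊗[ℚ] Sym, Sym.coeff₃ α β γ ((CoalgebraStruct.comul (R := ℚ)).lTensor Sym t) =
      Sym.coeff₂ α (join (β, γ)) t := by
    intro t
    induction t with
    | zero => simp
    | add t u ht hu => simp only [map_add, ht, hu]
    | tmul f g => simp [Sym.coeff₂_comul]
  simp only [LinearMap.comp_apply, LinearEquiv.coe_coe, h₁, h₂, Sym.coeff₂_comul]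
  exact Sym.coeff_congr (by simp only [parts_join, add_assoc]) f

theorem parts_zero {X : Type*} [Zero X] : parts (0 : ℕ →₀ X) = 0 := rfl

/-- Applying the counit to the first factor reads coefficients at `(0, α)`, and `join (0, α)` has
the nonzero entries of `α`. -/
theorem Sym.rTensor_counit_comp_comul : (CoalgebraStruct.counit (R := ℚ)).rTensor Sym ∘ₗ
    CoalgebraStruct.comul (R := ℚ) (A := Sym) = TensorProduct.mk ℚ ℚ Sym 1 := by
  refine LinearMap.ext fun f => (TensorProduct.lid ℚ Sym).injective (Sym.ext_coeff fun α => ?_)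
  have h : ∀ t : Sym ⊗[ℚ] Sym, Sym.coeff α (TensorProduct.lid ℚ Sym
      ((CoalgebraStruct.counit (R := ℚ)).rTensor Sym t)) = Sym.coeff₂ 0 α t := by
    intro t
    induction t with
    | zero => simp
    | add t u ht hu => simp only [map_add, ht, hu]
    | tmul f g => simp [Sym.counit_apply]
  rw [LinearMap.comp_apply, h, Sym.coeff₂_comul, TensorProduct.mk_apply, TensorProduct.lid_tmul,
    one_smul]
  exact Sym.coeff_congr (by rw [parts_join, parts_zero, zero_add]) f

theorem Sym.lTensor_counit_comp_comul : (CoalgebraStruct.counit (R := ℚ)).lTensor Sym ∘ₗ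
    CoalgebraStruct.comul (R := ℚ) (A := Sym) = (TensorProduct.mk ℚ Sym ℚ).flip 1 := by
  refine LinearMap.ext fun f => (TensorProduct.rid ℚ Sym).injective (Sym.ext_coeff fun α => ?_)
  have h : ∀ t : Sym ⊗[ℚ] Sym, Sym.coeff α (TensorProduct.rid ℚ Sym
      ((CoalgebraStruct.counit (R := ℚ)).lTensor Sym t)) = Sym.coeff₂ α 0 t := by
    intro t
    induction t with
    | zero => simp
    | add t u ht hu => simp only [map_add, ht, hu]
    | tmul f g => simp [Sym.counit_apply, mul_comm]
  rw [LinearMap.comp_apply, h, Sym.coeff₂_comul, LinearMap.flip_apply, TensorProduct.mk_apply,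
    TensorProduct.rid_tmul, one_smul]
  exact Sym.coeff_congr (by rw [parts_join, parts_zero, add_zero]) f

theorem Sym.counit_one : CoalgebraStruct.counit (R := ℚ) (1 : Sym) = 1 := by
  rw [Sym.counit_apply, Sym.coeff_one, if_pos rfl]

theorem Sym.counit_mul (f g : Sym) : CoalgebraStruct.counit (R := ℚ) (f * g) =
    CoalgebraStruct.counit (R := ℚ) f * CoalgebraStruct.counit (R := ℚ) g := by
  simp [Sym.counit_apply, Sym.coeff_mul]

/-- Exchanging `α` and `β` does not change the nonzero entries of `join (α, β)`. This
cocommutativity makes the antipode two-sided. -/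
theorem Sym.comm_comul (f : Sym) : TensorProduct.comm ℚ Sym Sym
    (CoalgebraStruct.comul (R := ℚ) f) = CoalgebraStruct.comul (R := ℚ) f := by
  refine Sym.ext_coeff₂ fun α β => ?_
  have h : ∀ t : Sym ⊗[ℚ] Sym, Sym.coeff₂ α β (TensorProduct.comm ℚ Sym Sym t) =
      Sym.coeff₂ β α t := by
    intro t
    induction t with
    | zero => simp
    | add t u ht hu => simp only [map_add, ht, hu]
    | tmul f g => simp [mul_comm]
  rw [h, Sym.coeff₂_comul, Sym.coeff₂_comul]
  exact Sym.coeff_congr (by simp only [parts_join, add_comm]) f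

/-! ### The antipode of `Sym` -/

theorem mem_unionPairs {l : Ptn} {p : Ptn × Ptn} :
    p ∈ unionPairs l ↔ p.1.2.parts + p.2.2.parts = l.2.parts := by
  simp [unionPairs]

theorem card_parts_lt_of_mem_unionPairs {l : Ptn} {p : Ptn × Ptn} (hp : p ∈ unionPairs l)
    (h : p.1 ≠ l) : p.1.2.parts.card < l.2.parts.card := by
  rw [mem_unionPairs] at hp
  refine Multiset.card_lt_card (lt_of_le_of_ne (hp ▸ Multiset.le_add_right _ _) fun h' => ?_)
  exact h (ptn_ext h')

/-- The empty partition. -/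
def Ptn.empty : Ptn := ptn 0

theorem Ptn.parts_empty : Ptn.empty.2.parts = 0 := rfl

theorem parts_eq_zero_iff {X : Type*} [Zero X] (K : ℕ →₀ X) : parts K = 0 ↔ K = 0 := by
  simp [parts]

theorem Sym.monomial_empty : Sym.monomial Ptn.empty = 1 := by
  classical
  refine Sym.ext_coeff fun α => ?_
  rw [Sym.coeff_monomial, Sym.coeff_one]
  simp only [shape_eq_iff, Ptn.parts_empty, parts_eq_zero_iff]

open Classical in
/-- The antipode of `Sym` on the monomial basis, by recursion on the number of parts. -/
def Sym.antipodeMonomial (l : Ptn) : Sym :=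
  algebraMap ℚ Sym (CoalgebraStruct.counit (R := ℚ) (Sym.monomial l)) -
    -- `attach` keeps the membership proof from which the number of parts is seen to drop.
    ∑ p ∈ ((unionPairs l).filter fun p => p.1 ≠ l).attach,
      Sym.antipodeMonomial p.1.1 * Sym.monomial p.1.2
termination_by l.2.parts.card
decreasing_by
  exact card_parts_lt_of_mem_unionPairs (Finset.mem_filter.1 p.2).1 (Finset.mem_filter.1 p.2).2

/-- The antipode of `Sym`. -/
def Sym.antipode : Sym →ₗ[ℚ] Sym := Sym.basis.constr ℚ Sym.antipodeMonomial

theorem Sym.antipode_monomial (l : Ptn) :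
    Sym.antipode (Sym.monomial l) = Sym.antipodeMonomial l := by
  rw [← Sym.basis_apply]
  exact Sym.basis.constr_basis ℚ _ l

/-- The only pair in `unionPairs l` with first component `l` is `(l, ∅)`, which contributes `S(m_l)
* 1`. The recursion defining `Sym.antipodeMonomial` is this identity on `m_l`, solved for that term.
-/
theorem Sym.mul_antipode_rTensor_comul :
    LinearMap.mul' ℚ Sym ∘ₗ Sym.antipode.rTensor Sym ∘ₗ CoalgebraStruct.comul =
      Algebra.linearMap ℚ Sym ∘ₗ CoalgebraStruct.counit := by
  classical
  refine Sym.hom_ext fun l => ?_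
  have hfilter : (unionPairs l).filter (fun p => p.1 = l) = {(l, Ptn.empty)} := by
    ext ⟨m, n⟩
    simp only [Finset.mem_filter, mem_unionPairs, Finset.mem_singleton, Prod.mk.injEq]
    refine ⟨fun ⟨h, h'⟩ => ⟨h', ptn_ext ?_⟩, ?_⟩
    · subst h'
      exact (left_eq_add.1 h.symm)
    · rintro ⟨rfl, rfl⟩
      exact ⟨add_zero _, rfl⟩
  simp only [LinearMap.comp_apply, Sym.comul_monomial, map_sum, LinearMap.rTensor_tmul,
    LinearMap.mul'_apply, Sym.antipode_monomial, Algebra.linearMap_apply]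
  rw [← Finset.sum_filter_add_sum_filter_not (unionPairs l) (fun p => p.1 = l), hfilter,
    Finset.sum_singleton, Sym.monomial_empty, mul_one, Sym.antipodeMonomial,
    Finset.sum_attach _ fun p : Ptn × Ptn => Sym.antipodeMonomial p.1 * Sym.monomial p.2,
    sub_add_cancel]

/-- Cocommutativity moves the antipode to the other tensor factor, and commutativity of the product
reduces this to the identity for `rTensor`. -/
theorem Sym.mul_antipode_lTensor_comul :
    LinearMap.mul' ℚ Sym ∘ₗ Sym.antipode.lTensor Sym ∘ₗ CoalgebraStruct.comul =
      Algebra.linearMap ℚ Sym ∘ₗ CoalgebraStruct.counit := by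
  rw [← Sym.mul_antipode_rTensor_comul]
  refine LinearMap.ext fun f => ?_
  simp only [LinearMap.comp_apply]
  conv_lhs => rw [← Sym.comm_comul]
  generalize CoalgebraStruct.comul (R := ℚ) f = t
  induction t with
  | zero => simp
  | add t u ht hu => simp only [map_add, ht, hu]
  | tmul f g => simp [mul_comm]

theorem Sym.isHopfAlgebra : IsHopfAlgebra Sym Sym.antipode where
  coassoc := Sym.coassoc
  rTensor_counit_comp_comul := Sym.rTensor_counit_comp_comul
  lTensor_counit_comp_comul := Sym.lTensor_counit_comp_comul
  counit_one := Sym.counit_one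
  counit_mul := Sym.counit_mul
  comul_one := Sym.comul_one
  comul_mul := Sym.comul_mul
  mul_antipode_rTensor_comul := Sym.mul_antipode_rTensor_comul
  mul_antipode_lTensor_comul := Sym.mul_antipode_lTensor_comul

/-! ### The product rule in `Sym` -/

/-- A coefficient of a product of two class indicators counts factorizations. It is stated for a
general monoid to serve both exponent sequences with `shape` and weak sentences with `wsort`. -/
theorem sum_antidiagonal_ite {M ι : Type*} [AddMonoid M] [Finset.HasAntidiagonal M]
    [DecidableEq ι] (key : M → ι) (i j : ι) (x : M) :
    ∑ p ∈ Finset.HasAntidiagonal.antidiagonal x,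
      (if key p.1 = i then (1 : ℚ) else 0) * (if key p.2 = j then 1 else 0) =
    Nat.card {p : M × M // key p.1 = i ∧ key p.2 = j ∧ p.1 + p.2 = x} := by
  rw [Nat.subtype_card ((Finset.HasAntidiagonal.antidiagonal x).filter
    fun p => key p.1 = i ∧ key p.2 = j), ← Finset.sum_boole]
  · refine Finset.sum_congr rfl fun p _ => ?_
    simp only [ite_and, ite_mul, one_mul, zero_mul]
  · intro p
    simp only [Finset.mem_filter, Finset.HasAntidiagonal.mem_antidiagonal]
    tauto

theorem Sym.monomial_mul_monomial (n k : ℕ) (l : n.Partition) (m : k.Partition) :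
    Sym.monomial ⟨n, l⟩ * Sym.monomial ⟨k, m⟩ =
      ∑ ν : (n + k).Partition,
        (ptnStructConst ⟨n, l⟩ ⟨k, m⟩ ⟨n + k, ν⟩ : ℚ) • Sym.monomial ⟨n + k, ν⟩ := by
  classical
  have hcoeff : ∀ q : Ptn, Sym.coeff (place q.toList) (Sym.monomial ⟨n, l⟩ * Sym.monomial ⟨k, m⟩) =
      ptnStructConst ⟨n, l⟩ ⟨k, m⟩ q := by
    intro q
    rw [Sym.coeff_mul]
    exact sum_antidiagonal_ite shape _ _ _
  refine Sym.basis.repr.injective (Finsupp.ext fun q => ?_)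
  rw [Sym.basis_repr_apply, Sym.basis_repr_apply, hcoeff, map_sum]
  simp only [map_smul, Sym.coeff_monomial, shape_place, smul_eq_mul, mul_ite, mul_one, mul_zero]
  by_cases hq : q.1 = n + k
  · obtain ⟨d, q⟩ := q
    obtain rfl : d = n + k := hq
    simp
  -- Outside degree `n + k` the right side has no term, and the structure constant counts nothing
  -- because degrees of exponent sequences add.
  · rw [Finset.sum_eq_zero fun ν _ => if_neg fun h => hq (by rw [h])]
    rw [ptnStructConst, Nat.cast_eq_zero, Nat.card_eq_zero]
    refine Or.inl ⟨?_⟩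
    rintro ⟨⟨α, β⟩, h₁, h₂, h₃⟩
    apply hq
    rw [← shape_place q, ← h₃, ← degree_eq, map_add, degree_eq, degree_eq, h₁, h₂]

/-! ### The rules of the colored monomial basis -/

open Classical in
theorem SymA.monomial_apply {A : Type*} [LinearOrder A] (P : PSent A) (K : WSent A) :
    (SymA.monomial P).1 K = if wsort K = P then 1 else 0 := rfl

theorem SymA.basis_repr_apply {A : Type*} [Finite A] [LinearOrder A] (f : SymA A) (P : PSent A) :
    (SymA.basis A).repr f P = f.1 (place P.1) := rfl

theorem SymA.mul_monomial_apply {A : Type*} [LinearOrder A] (P T Q : PSent A) :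
    (SymA.monomial P * SymA.monomial T).1 (place Q.1) = structConst P T Q := by
  classical
  exact sum_antidiagonal_ite wsort P T (place Q.1)

/-- The structure constants are the coordinates of the single element `m_P m_T` in the basis of the
`m_Q`. -/
theorem SymA.finite_structConst {A : Type*} [Finite A] [LinearOrder A] (P T : PSent A) :
    {Q | structConst P T Q ≠ 0}.Finite := by
  refine ((SymA.basis A).repr (SymA.monomial P * SymA.monomial T)).hasFiniteSupport.subset ?_
  intro Q hQ
  rw [Function.mem_support, SymA.basis_repr_apply, SymA.mul_monomial_apply]
  exact Nat.cast_ne_zero.2 hQ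

theorem SymA.monomial_mul_monomial {A : Type*} [Finite A] [LinearOrder A] (P T : PSent A) :
    SymA.monomial P * SymA.monomial T =
      ∑ᶠ Q, (structConst P T Q : ℚ) • SymA.monomial Q := by
  rw [finsum_eq_sum_of_support_subset (s := ((SymA.basis A).repr
    (SymA.monomial P * SymA.monomial T)).support)]
  · conv_lhs => rw [← (SymA.basis A).linearCombination_repr (SymA.monomial P * SymA.monomial T)]
    rw [Finsupp.linearCombination_apply, Finsupp.sum]
    refine Finset.sum_congr rfl fun Q _ => ?_
    rw [SymA.basis_repr_apply, SymA.mul_monomial_apply, SymA.basis_apply]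
  · intro Q hQ
    rw [Finset.mem_coe, Finsupp.mem_support_iff, SymA.basis_repr_apply, SymA.mul_monomial_apply]
    exact left_ne_zero_of_smul hQ

theorem coe_diff {A : Type*} [LinearOrder A] {P Q : PSent A} (h : SubSent Q P) :
    (Q.1 : Multiset (Word A)) + (P.diff Q).1 = P.1 := by
  classical
  rw [PSent.diff, coe_sort, ← Multiset.coe_sub]
  exact add_tsub_cancel_of_le h

theorem eq_diff_iff {A : Type*} [LinearOrder A] {P Q R : PSent A} (h : SubSent Q P) :
    R = P.diff Q ↔ (Q.1 : Multiset (Word A)) + R.1 = P.1 := by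
  rw [← coe_diff h, add_right_inj]
  exact ⟨fun h => h ▸ rfl, psent_ext⟩

theorem mem_subSents {A : Type*} [LinearOrder A] {P Q : PSent A} :
    Q ∈ subSents P ↔ (Q.1 : Multiset (Word A)) ≤ P.1 := by
  simp [subSents, SubSent]

/-- The inclusion into `QSym_A ⊗ QSym_A` is injective, and there `Δ(m_P)` is the sum of `M_J ⊗ M_K`
over the pairs whose concatenation sorts to `P`. Grouping by `Q = sort J` forces `sort K` to be
`P.diff Q`, and each group is `m_Q ⊗ m_{P.diff Q}`. -/
theorem SymA.comul_monomial {A : Type*} [Finite A] [LinearOrder A] (P : PSent A) :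
    CoalgebraStruct.comul (R := ℚ) (SymA.monomial P) =
      ∑ Q ∈ subSents P, SymA.monomial Q ⊗ₜ[ℚ] SymA.monomial (P.diff Q) := by
  classical
  refine map_incl_injective A ((SymA.map_incl_comul _).trans ?_)
  rw [comul_incl_monomial, map_sum]
  have hc : ∀ J K : Sent A, sort (J.concat K) = P ↔
      ((sort J).1 : Multiset (Word A)) + (sort K).1 = P.1 := by
    intro J K
    rw [sort_eq_iff, coe_sort, coe_sort, Multiset.coe_add]
    rfl
  rw [← Finset.sum_fiberwise_of_maps_to (t := subSents P) (g := fun p => sort p.1)]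
  · refine Finset.sum_congr rfl fun Q hQ => ?_
    rw [mem_subSents] at hQ
    rw [TensorProduct.map_tmul, SymA.incl_monomial, SymA.incl_monomial, TensorProduct.sum_tmul]
    simp only [TensorProduct.tmul_sum]
    rw [← Finset.sum_product']
    refine Finset.sum_congr ?_ fun _ _ => rfl
    ext ⟨J, K⟩
    simp only [Finset.mem_product, Set.Finite.mem_toFinset, Set.mem_ofPred_eq, Finset.mem_filter,
      hc]
    rw [and_comm, and_congr_right_iff]
    rintro rfl
    exact (eq_diff_iff hQ).symm
  · rintro ⟨J, K⟩ h
    simp only [Set.Finite.mem_toFinset, Set.mem_ofPred_eq, hc] at h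
    rw [mem_subSents, ← h]
    exact Multiset.le_add_right _ _

theorem wsort_zero_eq_iff {A : Type*} [LinearOrder A] (P : PSent A) :
    wsort (0 : WSent A) = P ↔ P = PSent.empty A := by
  rw [wsort_eq_iff, parts_zero]
  exact ⟨fun h => psent_ext h.symm, fun h => h ▸ rfl⟩

open Classical in
theorem SymA.counit_monomial {A : Type*} [Finite A] [LinearOrder A] (P : PSent A) :
    CoalgebraStruct.counit (R := ℚ) (SymA.monomial P) = if P = PSent.empty A then 1 else 0 :=
  if_congr (wsort_zero_eq_iff P) rfl rfl

/-! ### Transport of Hopf algebra structures -/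

/-- The coalgebra laws are not assumed on `B`; `e` only respects the operations. Each axiom on `B`
is compared with the one on `C` through `e` and its tensor powers, whose injectivity brings
equalities back. The antipode has to be the conjugate of `S`. -/
theorem IsHopfAlgebra.of_equiv {B C : Type*} [Ring B] [Algebra ℚ B] [CoalgebraStruct ℚ B]
    [Ring C] [Algebra ℚ C] [CoalgebraStruct ℚ C] {S : C →ₗ[ℚ] C} (hC : IsHopfAlgebra C S)
    (e : B ≃ₐc[ℚ] C) :
    IsHopfAlgebra B ((e : B ≃ₗ[ℚ] C).symm.toLinearMap ∘ₗ S ∘ₗ (e : B ≃ₗ[ℚ] C).toLinearMap) := by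
  set E : B ≃ₗ[ℚ] C := (e : B ≃ₗ[ℚ] C)
  have hmul : ∀ a b, E (a * b) = E a * E b := map_mul e
  have hone : E 1 = 1 := map_one e
  have hcounit : ∀ b, CoalgebraStruct.counit (R := ℚ) (E b) = CoalgebraStruct.counit (R := ℚ) b :=
    fun b => congr($(e.counit_comp) b)
  set T := TensorProduct.congr E E
  have hcomul : ∀ b, CoalgebraStruct.comul (R := ℚ) (E b) = T (CoalgebraStruct.comul (R := ℚ) b) :=
    fun b => congr($(e.map_comp_comul) b).symm
  have hTtmul : ∀ a b, T (a ⊗ₜ b) = E a ⊗ₜ E b := fun _ _ => rfl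
  have hTmul : ∀ t u, T (t * u) = T t * T u := by
    intro t u
    induction t with
    | zero => simp
    | add t t' h h' => simp only [add_mul, map_add, h, h']
    | tmul a b =>
      induction u with
      | zero => simp
      | add u u' h h' => simp only [mul_add, map_add, h, h']
      | tmul a' b' => simp only [Algebra.TensorProduct.tmul_mul_tmul, hTtmul, hmul]
  have hμ : ∀ t, E (LinearMap.mul' ℚ B t) = LinearMap.mul' ℚ C (T t) := by
    intro t
    induction t with
    | zero => simp
    | add t u h h' => simp only [map_add, h, h']
    | tmul a b => simp only [LinearMap.mul'_apply, hTtmul, hmul]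
  have hη : ∀ r : ℚ, E (algebraMap ℚ B r) = algebraMap ℚ C r := by
    intro r
    rw [Algebra.algebraMap_eq_smul_one, map_smul, hone, Algebra.algebraMap_eq_smul_one]
  refine ⟨?_, ?_, ?_, ?_, ?_, ?_, ?_, ?_, ?_⟩
  · refine LinearMap.ext fun b => (TensorProduct.congr E T).injective ?_
    have h₁ : ∀ t, TensorProduct.congr E T (TensorProduct.assoc ℚ B B B
        ((CoalgebraStruct.comul (R := ℚ)).rTensor B t)) =
        TensorProduct.assoc ℚ C C C ((CoalgebraStruct.comul (R := ℚ)).rTensor C (T t)) := by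
      intro t
      induction t with
      | zero => simp
      | add t u h h' => simp only [map_add, h, h']
      | tmul a b =>
        rw [LinearMap.rTensor_tmul, hTtmul, LinearMap.rTensor_tmul, hcomul]
        generalize CoalgebraStruct.comul (R := ℚ) a = t
        induction t with
        | zero => simp
        | add t u h h' => simp only [TensorProduct.add_tmul, map_add, h, h']
        | tmul a a' => simp only [TensorProduct.assoc_tmul, TensorProduct.congr_tmul, hTtmul]
    have h₂ : ∀ t, TensorProduct.congr E T ((CoalgebraStruct.comul (R := ℚ)).lTensor B t) =
        (CoalgebraStruct.comul (R := ℚ)).lTensor C (T t) := by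
      intro t
      induction t with
      | zero => simp
      | add t u h h' => simp only [map_add, h, h']
      | tmul a b => simp only [LinearMap.lTensor_tmul, TensorProduct.congr_tmul, hTtmul, hcomul]
    simp only [LinearMap.comp_apply, LinearEquiv.coe_coe, h₁, h₂, ← hcomul]
    exact congr($(hC.coassoc) (E b))
  · refine LinearMap.ext fun b => (TensorProduct.congr (.refl ℚ ℚ) E).injective ?_
    have h : ∀ t, TensorProduct.congr (.refl ℚ ℚ) E
        ((CoalgebraStruct.counit (R := ℚ)).rTensor B t) =
        (CoalgebraStruct.counit (R := ℚ)).rTensor C (T t) := by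
      intro t
      induction t with
      | zero => simp
      | add t u h h' => simp only [map_add, h, h']
      | tmul a b => simp [hTtmul, hcounit]
    rw [LinearMap.comp_apply, h, ← hcomul]
    exact congr($(hC.rTensor_counit_comp_comul) (E b))
  · refine LinearMap.ext fun b => (TensorProduct.congr E (.refl ℚ ℚ)).injective ?_
    have h : ∀ t, TensorProduct.congr E (.refl ℚ ℚ)
        ((CoalgebraStruct.counit (R := ℚ)).lTensor B t) =
        (CoalgebraStruct.counit (R := ℚ)).lTensor C (T t) := by
      intro t
      induction t with
      | zero => simp
      | add t u h h' => simp only [map_add, h, h']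
      | tmul a b => simp [hTtmul, hcounit]
    rw [LinearMap.comp_apply, h, ← hcomul]
    exact congr($(hC.lTensor_counit_comp_comul) (E b))
  · rw [← hcounit, hone, hC.counit_one]
  · intro a b
    rw [← hcounit, hmul, hC.counit_mul, hcounit, hcounit]
  · apply T.injective
    rw [← hcomul, hone, hC.comul_one, Algebra.TensorProduct.one_def,
      Algebra.TensorProduct.one_def, hTtmul, hone]
  · intro a b
    apply T.injective
    rw [← hcomul, hmul, hC.comul_mul, hcomul, hcomul, hTmul]
  · refine LinearMap.ext fun b => E.injective ?_
    have h : ∀ t, T ((E.symm.toLinearMap ∘ₗ S ∘ₗ E.toLinearMap).rTensor B t) =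
        S.rTensor C (T t) := by
      intro t
      induction t with
      | zero => simp
      | add t u h h' => simp only [map_add, h, h']
      | tmul a b => simp [hTtmul]
    simp only [LinearMap.comp_apply, hμ, h, ← hcomul, Algebra.linearMap_apply, hη, ← hcounit b]
    exact congr($(hC.mul_antipode_rTensor_comul) (E b))
  · refine LinearMap.ext fun b => E.injective ?_
    have h : ∀ t, T ((E.symm.toLinearMap ∘ₗ S ∘ₗ E.toLinearMap).lTensor B t) =
        S.lTensor C (T t) := by
      intro t
      induction t with
      | zero => simp
      | add t u h h' => simp only [map_add, h, h']
      | tmul a b => simp [hTtmul]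
    simp only [LinearMap.comp_apply, hμ, h, ← hcomul, Algebra.linearMap_apply, hη, ← hcounit b]
    exact congr($(hC.mul_antipode_lTensor_comul) (E b))

/-! ### The alphabet with one letter -/

section Unary

variable {A : Type*}

/-- A word over a one-letter alphabet is determined by its length. -/
def lengthEquiv [Unique A] : Word A ≃+ ℕ where
  toFun := FreeAddMonoid.length
  invFun n := FreeAddMonoid.ofList (List.replicate n default)
  left_inv _ := FreeAddMonoid.toList.injective
    (List.eq_replicate_iff.2 ⟨rfl, fun _ _ => Subsingleton.elim _ _⟩).symm
  right_inv _ := List.length_replicate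
  map_add' := FreeAddMonoid.length_add

/-- The sequence of word lengths of a weak sentence over a one-letter alphabet. -/
def lengthsEquiv [Unique A] : WSent A ≃+ (ℕ →₀ ℕ) where
  __ := Finsupp.mapRange.equiv (lengthEquiv (A := A)).toEquiv rfl
  map_add' _ _ := Finsupp.ext fun _ => map_add lengthEquiv _ _

theorem lengthsEquiv_apply [Unique A] (K : WSent A) (i : ℕ) :
    lengthsEquiv K i = (K i).length := rfl

/-- Only the empty word has length zero, so the support does not change. -/
theorem parts_lengthsEquiv [Unique A] (K : WSent A) :
    parts (lengthsEquiv K) = (parts K).map FreeAddMonoid.length := by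
  have hs : (lengthsEquiv K).support = K.support := by
    ext i
    simp [lengthsEquiv_apply, FreeAddMonoid.length_eq_zero]
  rw [parts, parts, hs, Multiset.map_map]
  rfl

variable [LinearOrder A]

theorem parts_wordLengths (P : PSent A) :
    (wordLengths P).2.parts = (P.1 : Multiset (Word A)).map FreeAddMonoid.length := by
  have h : ∀ n ∈ (P.1.map FreeAddMonoid.length : Multiset ℕ), n ≠ 0 := by
    intro n hn h0
    obtain ⟨w, hw, rfl⟩ := List.mem_map.1 hn
    exact P.2.1 (FreeAddMonoid.length_eq_zero.1 h0 ▸ hw)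
  -- `ptn` discards zeros, and a p-sentence has no empty word to produce one.
  exact Multiset.filter_eq_self.2 h

theorem wordLengths_injective [Unique A] :
    Function.Injective (wordLengths : PSent A → Ptn) := by
  intro P Q h
  refine psent_ext (Multiset.map_injective (lengthEquiv (A := A)).injective ?_)
  have := congrArg (fun l : Ptn => l.2.parts) h
  rwa [parts_wordLengths, parts_wordLengths] at this

/-- Sorting only rearranges the nonempty words, so both partitions have the nonzero word lengths of
`K` as parts. -/
theorem shape_lengthsEquiv [Unique A] (K : WSent A) :
    shape (lengthsEquiv K) = wordLengths (wsort K) := by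
  rw [shape_eq_iff, parts_lengthsEquiv, parts_wordLengths, (wsort_eq_iff K _).1 rfl]

theorem wordLengths_bijective [Unique A] :
    Function.Bijective (wordLengths : PSent A → Ptn) := by
  -- The preimage of `l` has one word for each part of `l`, of that length.
  refine ⟨wordLengths_injective, fun l => ⟨wsort (lengthsEquiv.symm (place l.toList)), ?_⟩⟩
  rw [← shape_lengthsEquiv, AddEquiv.apply_symm_apply, shape_place]

/-- The structure constants refer to a definite sequence, so equality of multisets is not enough.
Words that decrease in the graded lexicographic order have weakly decreasing lengths, hence the list
of lengths is already the sorted list of parts. -/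
theorem lengthsEquiv_place [Unique A] (P : PSent A) :
    lengthsEquiv (place P.1) = place (wordLengths P).toList := by
  have h : (wordLengths P).toList = P.1.map FreeAddMonoid.length := by
    refine List.Perm.eq_of_pairwise' (r := (· ≥ ·)) ?_ ?_ ?_
    · exact Multiset.pairwise_sort _ _
    · rw [List.pairwise_map]
      exact P.2.2.imp fun h => h.elim le_of_lt fun h => h.1.le
    · rw [← Multiset.coe_eq_coe, Ptn.toList, Multiset.sort_eq, parts_wordLengths]
      rfl
  rw [h]
  ext i
  simp only [lengthsEquiv_apply, place, List.toFinsupp_apply]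
  -- Past the end of the list the default entry is the empty word, whose length is the default `0`.
  exact (List.getD_map P.1 (0 : Word A) FreeAddMonoid.length).symm

/-- Taking lengths in both components is a bijection between the two sets of pairs being counted: it
respects sums, sorting types and the target sequence. -/
theorem structConst_eq [Unique A] (P T Q : PSent A) :
    structConst P T Q = ptnStructConst (wordLengths P) (wordLengths T) (wordLengths Q) := by
  refine Nat.card_congr (Equiv.subtypeEquiv
    (Equiv.prodCongr lengthsEquiv.toEquiv lengthsEquiv.toEquiv) ?_)
  rintro ⟨Y, Z⟩
  simp only [Equiv.prodCongr_apply, Prod.map, AddEquiv.toEquiv_eq_coe, AddEquiv.coe_toEquiv,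
    shape_lengthsEquiv, wordLengths_injective.eq_iff, ← map_add, ← lengthsEquiv_place,
    EmbeddingLike.apply_eq_iff_eq]

/-- Both partitions of a pair come from p-sentences. As length is injective on words, an equality of
multisets of lengths lifts to one of multisets of words, and this forces the second p-sentence to be
`P.diff Q`. -/
theorem mem_unionPairs_wordLengths [Unique A] (P : PSent A) (p : Ptn × Ptn) :
    p ∈ unionPairs (wordLengths P) ↔
      ∃ Q ∈ subSents P, p = (wordLengths Q, wordLengths (P.diff Q)) := by
  constructor
  · obtain ⟨l, m⟩ := p
    obtain ⟨Q, rfl⟩ := wordLengths_bijective (A := A).2 l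
    obtain ⟨R, rfl⟩ := wordLengths_bijective (A := A).2 m
    intro h
    rw [mem_unionPairs] at h
    simp only [parts_wordLengths, ← Multiset.map_add] at h
    have h := Multiset.map_injective (lengthEquiv (A := A)).injective h
    have hQ : SubSent Q P := (Multiset.le_add_right _ _).trans_eq h
    exact ⟨Q, mem_subSents.2 hQ, by rw [(eq_diff_iff hQ).2 h]⟩
  · rintro ⟨Q, hQ, rfl⟩
    simp only [mem_unionPairs, parts_wordLengths]
    rw [← Multiset.map_add, coe_diff (mem_subSents.1 hQ)]

/-! ### The uncoloring map as an isomorphism of bialgebras -/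

variable [Finite A]

theorem uncolor_monomial (P : PSent A) :
    uncolor A (SymA.monomial P) = Sym.monomial (wordLengths P) := by
  rw [← SymA.basis_apply]
  exact (SymA.basis A).constr_basis ℚ _ P

/-- By linearity this is a comparison of indicators on the `m_P`: `K` sorts to `P` exactly when its
length sequence has shape `wordLengths P`. -/
theorem coeff_uncolor [Unique A] (f : SymA A) (K : WSent A) :
    Sym.coeff (lengthsEquiv K) (uncolor A f) = f.1 K := by
  let ev : SymA A →ₗ[ℚ] ℚ :=
    { toFun := fun f => f.1 K, map_add' := fun _ _ => rfl, map_smul' := fun _ _ => rfl }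
  have h : Sym.coeff (lengthsEquiv K) ∘ₗ uncolor A = ev := by
    classical
    refine (SymA.basis A).ext fun P => ?_
    rw [SymA.basis_apply, LinearMap.comp_apply, uncolor_monomial, Sym.coeff_monomial]
    refine (if_congr ?_ rfl rfl).trans (SymA.monomial_apply P K).symm
    rw [shape_lengthsEquiv, wordLengths_injective.eq_iff]
  exact congr($h f)

/-- The additive bijection `lengthsEquiv` matches the factorizations of a monomial with those of its
image, and `coeff_uncolor` matches the coefficients. -/
theorem uncolor_mul [Unique A] (f g : SymA A) :
    uncolor A (f * g) = uncolor A f * uncolor A g := by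
  classical
  refine Sym.ext_coeff fun α => ?_
  obtain ⟨K, rfl⟩ := (lengthsEquiv (A := A)).surjective α
  rw [coeff_uncolor, Sym.coeff_mul]
  refine Finset.sum_equiv
    (Equiv.prodCongr (lengthsEquiv (A := A)).toEquiv lengthsEquiv.toEquiv) ?_ ?_
  · rintro ⟨Y, Z⟩
    simp only [Equiv.prodCongr_apply, Prod.map, AddEquiv.toEquiv_eq_coe, AddEquiv.coe_toEquiv,
      Finset.HasAntidiagonal.mem_antidiagonal, ← map_add, EmbeddingLike.apply_eq_iff_eq]
  · rintro ⟨Y, Z⟩ _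
    exact (congrArg₂ (· * ·) (coeff_uncolor f Y) (coeff_uncolor g Z)).symm

theorem uncolor_bijective [Unique A] : Function.Bijective (uncolor A) := by
  have h : uncolor A = ((SymA.basis A).equiv Sym.basis
      (Equiv.ofBijective _ wordLengths_bijective)).toLinearMap := by
    refine (SymA.basis A).ext fun P => ?_
    rw [SymA.basis_apply, uncolor_monomial, ← SymA.basis_apply, LinearEquiv.coe_coe,
      Module.Basis.equiv_apply, Sym.basis_apply]
    rfl
  rw [h]
  exact LinearEquiv.bijective _

theorem counit_uncolor [Unique A] (f : SymA A) :
    CoalgebraStruct.counit (R := ℚ) (uncolor A f) = CoalgebraStruct.counit (R := ℚ) f := by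
  rw [Sym.counit_apply, ← map_zero (lengthsEquiv (A := A)), coeff_uncolor]
  rfl

theorem map_uncolor_comul [Unique A] (f : SymA A) :
    TensorProduct.map (uncolor A) (uncolor A) (CoalgebraStruct.comul (R := ℚ) f) =
      CoalgebraStruct.comul (R := ℚ) (uncolor A f) := by
  classical
  have h : TensorProduct.map (uncolor A) (uncolor A) ∘ₗ CoalgebraStruct.comul (R := ℚ) =
      CoalgebraStruct.comul (R := ℚ) ∘ₗ uncolor A := by
    refine (SymA.basis A).ext fun P => ?_
    simp only [LinearMap.comp_apply, SymA.basis_apply, SymA.comul_monomial, uncolor_monomial,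
      map_sum, TensorProduct.map_tmul, Sym.comul_monomial]
    have himage : unionPairs (wordLengths P) =
        (subSents P).image fun Q => (wordLengths Q, wordLengths (P.diff Q)) := by
      ext p
      rw [mem_unionPairs_wordLengths, Finset.mem_image]
      simp only [eq_comm]
    rw [himage, Finset.sum_image]
    -- The first component of the pair already determines `Q`, so no term of the coproduct is merged
    -- with another.
    exact fun Q _ R _ h => wordLengths_injective (Prod.ext_iff.1 h).1
  exact congr($h f)

/-- The uncoloring map as an isomorphism of bialgebras. -/
def uncolorEquiv (A : Type*) [Finite A] [LinearOrder A] [Unique A] : SymA A ≃ₐc[ℚ] Sym where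
  __ := uncolor A
  __ := Equiv.ofBijective (uncolor A) uncolor_bijective
  map_mul' := uncolor_mul
  counit_comp := LinearMap.ext counit_uncolor
  map_comp_comul := LinearMap.ext map_uncolor_comul

end Unary

end

end ColoredSym

theorem mainTheorem6 (A : Type*) [Finite A] [LinearOrder A] (hA : Nat.card A = 1) :
    -- the uncoloring map is an isomorphism of Hopf algebras
    (∃ (SA : ColoredSym.SymA A →ₗ[ℚ] ColoredSym.SymA A)
        (S : ColoredSym.Sym →ₗ[ℚ] ColoredSym.Sym)
        (υ : ColoredSym.SymA A ≃ₐc[ℚ] ColoredSym.Sym),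
      ColoredSym.IsHopfAlgebra (ColoredSym.SymA A) SA ∧
      ColoredSym.IsHopfAlgebra ColoredSym.Sym S ∧
      (∀ f, υ f = ColoredSym.uncolor A f) ∧
      (∀ P : ColoredSym.PSent A, υ (ColoredSym.SymA.monomial P) =
        ColoredSym.Sym.monomial (ColoredSym.wordLengths P)) ∧
      (∀ f, υ (SA f) = S (υ f))) ∧
    -- the product, coproduct and counit rules of the colored monomial basis
    (∀ P T : ColoredSym.PSent A,
      {Q | ColoredSym.structConst P T Q ≠ 0}.Finite ∧
      ColoredSym.SymA.monomial P * ColoredSym.SymA.monomial T =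
        ∑ᶠ Q, (ColoredSym.structConst P T Q : ℚ) • ColoredSym.SymA.monomial Q) ∧
    (∀ P : ColoredSym.PSent A,
      CoalgebraStruct.comul (R := ℚ) (ColoredSym.SymA.monomial P) =
        ∑ Q ∈ ColoredSym.subSents P,
          ColoredSym.SymA.monomial Q ⊗ₜ[ℚ] ColoredSym.SymA.monomial (P.diff Q)) ∧
    CoalgebraStruct.counit (R := ℚ) (ColoredSym.SymA.monomial (ColoredSym.PSent.empty A)) = 1 ∧
    (∀ P : ColoredSym.PSent A, P ≠ ColoredSym.PSent.empty A →
      CoalgebraStruct.counit (R := ℚ) (ColoredSym.SymA.monomial P) = 0) ∧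
    -- the product and coproduct rules of the monomial basis of the symmetric functions
    (∀ (n k : ℕ) (l : n.Partition) (m : k.Partition),
      ColoredSym.Sym.monomial ⟨n, l⟩ * ColoredSym.Sym.monomial ⟨k, m⟩ =
        ∑ ν : (n + k).Partition,
          (ColoredSym.ptnStructConst ⟨n, l⟩ ⟨k, m⟩ ⟨n + k, ν⟩ : ℚ) •
            ColoredSym.Sym.monomial ⟨n + k, ν⟩) ∧
    (∀ l : ColoredSym.Ptn, CoalgebraStruct.comul (R := ℚ) (ColoredSym.Sym.monomial l) =
      ∑ p ∈ ColoredSym.unionPairs l,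
        ColoredSym.Sym.monomial p.1 ⊗ₜ[ℚ] ColoredSym.Sym.monomial p.2) ∧
    -- the rules match under the bijection `P ↦ wℓ(P)` from p-sentences to partitions
    Function.Bijective (ColoredSym.wordLengths : ColoredSym.PSent A → ColoredSym.Ptn) ∧
    (∀ P T Q : ColoredSym.PSent A, ColoredSym.structConst P T Q =
      ColoredSym.ptnStructConst (ColoredSym.wordLengths P) (ColoredSym.wordLengths T)
        (ColoredSym.wordLengths Q)) ∧
    (∀ (P : ColoredSym.PSent A) (p : ColoredSym.Ptn × ColoredSym.Ptn),
      p ∈ ColoredSym.unionPairs (ColoredSym.wordLengths P) ↔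
        ∃ Q ∈ ColoredSym.subSents P,
          p = (ColoredSym.wordLengths Q, ColoredSym.wordLengths (P.diff Q))) := by
  have : Unique A := @Classical.choice (Unique A) (by
    obtain ⟨_, ⟨a⟩⟩ := Nat.card_eq_one_iff_unique.1 hA
    exact ⟨⟨⟨a⟩, fun _ => Subsingleton.elim _ _⟩⟩)
  refine ⟨⟨_, ColoredSym.Sym.antipode, ColoredSym.uncolorEquiv A,
      ColoredSym.Sym.isHopfAlgebra.of_equiv (ColoredSym.uncolorEquiv A),
      ColoredSym.Sym.isHopfAlgebra, fun _ => rfl, ColoredSym.uncolor_monomial, fun f => ?_⟩,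
    fun P T => ⟨ColoredSym.SymA.finite_structConst P T,
      ColoredSym.SymA.monomial_mul_monomial P T⟩,
    ColoredSym.SymA.comul_monomial, ?_, fun P hP => ?_,
    ColoredSym.Sym.monomial_mul_monomial, ColoredSym.Sym.comul_monomial,
    ColoredSym.wordLengths_bijective, ColoredSym.structConst_eq,
    ColoredSym.mem_unionPairs_wordLengths⟩
  -- The antipode of `Sym_A` is `υ⁻¹ ∘ S ∘ υ`, so applying `υ` cancels `υ⁻¹`.
  · exact LinearEquiv.apply_symm_apply
      (ColoredSym.uncolorEquiv A : ColoredSym.SymA A ≃ₗ[ℚ] ColoredSym.Sym) _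
  · rw [ColoredSym.SymA.counit_monomial, if_pos rfl]
  · rw [ColoredSym.SymA.counit_monomial, if_neg hP]
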